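/- Let $M$ be a smooth $n$-dimensional manifold with a smooth commutative associative product $\circ$ on $TM$, with unit vector field $e$, satisfying the Hertling–Manin condition (an $F$-manifold), and suppose that it is semisimple: around every point there are coordinates (canonical coordinates) in which $\partial_j\circ\partial_k=\delta_{jk}\,\partial_k$. Let $E$ be an eventual identity (a vector field invertible for $\circ$ such that $X*Y=X\circ Y\circ E^{-1}$ is again an $F$-manifold structure) and $L=E\,\circ$. A smooth torsionless connection $\nabla$ with curvature $R$ is compatible with $\circ$ if $(\nabla_X\circ)(Y,Z)=(\nabla_Y\circ)(X,Z)$ and $Z\circ R(W,Y)(X)+W\circ R(Y,Z)(X)+Y\circ R(Z,W)(X)=0$ for all vector fields $X,Y,Z,W$. For a vector field $X$ and an endomorphism field $V$ of $TM$ put $(d_\nabla X)(Y)=\nabla_YX$ and $(d_\nabla V)(Y,Z)=\nabla_Y(VZ)-\nabla_Z(VY)-V[Y,Z]$. Two connections $\nabla,\tilde\nabla$ compatible with $\circ$ are hydrodynamically equivalent if $(d_\nabla-d_{\tilde\nabla})(X\circ)=0$ for every vector field $X$. Let $\nabla^{(1)},\nabla^{(2)}$ be two flat (zero curvature) connections compatible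 with $\circ$ and hydrodynamically equivalent. Consider, for smooth vector fields on open subsets of $M$, the equation $$d_{\nabla^{(1)}}d_{\nabla^{(2)}}X=0.\qquad(\star)$$ 1. Let $U\subseteq M$ be open, let $X_{(p)}$ be a solution of $(\star)$ on $U$ and let $X_{(p+1)}$ be a smooth vector field on $U$ with $$d_{\nabla^{(1)}}X_{(p+1)}=d_{\nabla^{(2)}}X_{(p)}.\qquad(\star\star)$$ Then $X_{(p+1)}$ is again a solution of $(\star)$ on $U$. If moreover $d_{\nabla^{(1)}}X_{(p)}$ commutes with $L$ on $U$, then so does $d_{\nabla^{(1)}}X_{(p+1)}$. 2. The recursion can be carried out locally: if $X_{(0)}$ is a solution of $(\star)$ on an open set $U$, then every point of $U$ has an open neighbourhood $V\subseteq U$ on which there are solutions $X_{(0)},X_{(1)},X_{(2)},\dots$ of $(\star)$ satisfying $(\star\star)$ for all $p\ge 0$; if $d_{\nabla^{(1)}}X_{(0)}$ commutes with $L$ on $U$, all $d_{\nabla^{(1)}}X_{(p)}$ commute with $L$ on $V$. 3. (Lenard–Magri chain.) Every point of $M$ has an open neighbourhood with a frame of $\nabla^{(1)}$-flat vector fields.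 For every frame $X_{(0,1)},\dots,X_{(0,n)}$ of $\nabla^{(1)}$-flat vector fields on an open set $U$, every point of $U$ has an open neighbourhood $V\subseteq U$ with vector fields $X_{(p,\alpha)}$ on $V$ ($p\ge 0$, $1\le\alpha\le n$), starting from the given frame, such that $d_{\nabla^{(1)}}X_{(p+1,\alpha)}=d_{\nabla^{(2)}}X_{(p,\alpha)}$, every $X_{(p,\alpha)}$ solves $(\star)$, and every $d_{\nabla^{(1)}}X_{(p,\alpha)}$ commutes with $L$. -/

import Mathlib

open scoped Manifold ContDiff Topology

noncomputable section

namespace FMan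

/-- Vector fields on the `n`-dimensional manifold `M` (no regularity imposed). -/
abbrev VField (n : ℕ) (M : Type*) [TopologicalSpace M]
    [ChartedSpace (EuclideanSpace ℝ (Fin n)) M] :=
  Π x : M, TangentSpace (𝓡 n) x

/-- Fields of endomorphisms of `TM`, that is `TM`-valued one-forms (no regularity imposed). -/
abbrev EndField (n : ℕ) (M : Type*) [TopologicalSpace M]
    [ChartedSpace (EuclideanSpace ℝ (Fin n)) M] :=
  Π x : M, TangentSpace (𝓡 n) x →L[ℝ] TangentSpace (𝓡 n) x

/-- `(1,2)`-tensor fields, `c x v w` being the product of `v` and `w` (no regularity imposed). -/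
abbrev MulField (n : ℕ) (M : Type*) [TopologicalSpace M]
    [ChartedSpace (EuclideanSpace ℝ (Fin n)) M] :=
  Π x : M, TangentSpace (𝓡 n) x →L[ℝ] TangentSpace (𝓡 n) x →L[ℝ] TangentSpace (𝓡 n) x

/-- Affine connections on `M`; `D Y x (X x)` is `(∇_X Y)(x)`. -/
abbrev AffConn (n : ℕ) (M : Type*) [TopologicalSpace M]
    [ChartedSpace (EuclideanSpace ℝ (Fin n)) M] [IsManifold (𝓡 n) ∞ M] :=
  CovariantDerivative (𝓡 n) (EuclideanSpace ℝ (Fin n))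
    (TangentSpace (𝓡 n) : M → Type _)

section

variable {n : ℕ} {M : Type*} [TopologicalSpace M]
  [ChartedSpace (EuclideanSpace ℝ (Fin n)) M]

section
variable [IsManifold (𝓡 n) ∞ M]

/-- The vector field `X` is smooth at `x`. -/
def SmoothAt (X : VField n M) (x : M) : Prop :=
  ContMDiffAt (𝓡 n) (𝓡 n).tangent ∞
    (fun y => (⟨y, X y⟩ : TangentBundle (𝓡 n) M)) x

/-- The vector field `X` is smooth at every point of `U` (used for open `U` only). -/
def SmoothOn (X : VField n M) (U : Set M) : Prop :=
  ∀ x ∈ U, SmoothAt X x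

end

/-- The Lie bracket of vector fields. -/
abbrev bracket (X Y : VField n M) : VField n M :=
  VectorField.mlieBracket (𝓡 n) X Y

/-- The product `X ∘ Y` of two vector fields. -/
def mul (c : MulField n M) (X Y : VField n M) : VField n M :=
  fun x => c x (X x) (Y x)

/-- The endomorphism field `X ∘`. -/
def mulBy (c : MulField n M) (X : VField n M) : EndField n M :=
  fun x => c x (X x)

/-- The product `X * Y = F ∘ (X ∘ Y)`; for an invertible vector field `E` it is used with
`F = E⁻¹`, so that (the product being commutative) `X * Y = X ∘ Y ∘ E⁻¹`. -/
def twist (c : MulField n M) (F : VField n M) : MulField n M :=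
  fun x => ((c x (F x)).postcomp (TangentSpace (𝓡 n) x)).comp (c x)

theorem twist_apply (c : MulField n M) (F : VField n M) (x : M)
    (v w : TangentSpace (𝓡 n) x) : twist c F x v w = c x (F x) (c x v w) := rfl

/-- An `F`-manifold structure on `M`: a smooth commutative associative product `∘` on `TM`
satisfying the Hertling-Manin condition, with a smooth unit vector field `e`. -/
structure IsFManifold [IsManifold (𝓡 n) ∞ M] (c : MulField n M) (e : VField n M) : Prop where
  smooth_mul : ∀ (X Y : VField n M) (x : M), SmoothAt X x → SmoothAt Y x →
    SmoothAt (mul c X Y) x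
  smooth_unit : ∀ x, SmoothAt e x
  comm : ∀ x v w, c x v w = c x w v
  assoc : ∀ x u v w, c x (c x u v) w = c x u (c x v w)
  unit : ∀ x v, c x (e x) v = v
  hertling_manin : ∀ (X Y Z W : VField n M) (x : M),
    SmoothAt X x → SmoothAt Y x → SmoothAt Z x → SmoothAt W x →
    (bracket (mul c X Y) (mul c Z W)
      - mul c (bracket (mul c X Y) Z) W - mul c (bracket (mul c X Y) W) Z
      - mul c X (bracket Y (mul c Z W)) + mul c (mul c X (bracket Y Z)) W
      + mul c (mul c X (bracket Y W)) Z
      - mul c Y (bracket X (mul c Z W)) + mul c (mul c Y (bracket X Z)) W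
      + mul c (mul c Y (bracket X W)) Z) x = 0

/-- The components `(du¹(v), …, duⁿ(v))` of a tangent vector `v` in the local coordinates
`φ = (u¹, …, uⁿ)`. -/
def components (φ : OpenPartialHomeomorph M (EuclideanSpace ℝ (Fin n))) (x : M)
    (v : TangentSpace (𝓡 n) x) : EuclideanSpace ℝ (Fin n) :=
  mfderiv (𝓡 n) (𝓡 n) φ x v

/-- Semisimplicity: around every point there are canonical coordinates `φ = (u¹, …, uⁿ)`, i.e.
smooth coordinates in which `c^i_{jk} = δ^i_j δ^i_k`, which says that the components of tangent
vectors are multiplied one by one. -/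
def IsSemisimple (c : MulField n M) : Prop :=
  ∀ p : M, ∃ φ ∈ IsManifold.maximalAtlas (𝓡 n) ∞ M, p ∈ φ.source ∧
    ∀ x ∈ φ.source, ∀ (v w : TangentSpace (𝓡 n) x) (i : Fin n),
      components φ x (c x v w) i = components φ x v i * components φ x w i

section
variable [IsManifold (𝓡 n) ∞ M]

/-- `E` is an eventual identity of the `F`-manifold `(M, c, e)`: it is invertible, and
`X * Y = X ∘ Y ∘ E⁻¹` is a new `F`-manifold structure (with unit `E`). -/
def IsEventualIdentity (c : MulField n M) (e E : VField n M) : Prop :=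
  (∀ x, SmoothAt E x) ∧
  ∃ F : VField n M, (∀ x, SmoothAt F x) ∧ (∀ x, c x (E x) (F x) = e x) ∧
    IsFManifold (twist c F) E

/-- The vector field `∇_X Y`. -/
def cov (D : AffConn n M) (X Y : VField n M) : VField n M :=
  fun x => D Y x (X x)

/-- The curvature `R(X, Y)(Z) = ∇_X ∇_Y Z - ∇_Y ∇_X Z - ∇_{[X,Y]} Z`. -/
def curv (D : AffConn n M) (X Y Z : VField n M) : VField n M :=
  cov D X (cov D Y Z) - cov D Y (cov D X Z) - cov D (bracket X Y) Z

/-- The connection has zero curvature. -/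
def IsFlat (D : AffConn n M) : Prop :=
  ∀ (X Y Z : VField n M) (x : M), SmoothAt X x → SmoothAt Y x → SmoothAt Z x →
    curv D X Y Z x = 0

/-- The covariant derivative `(∇_X ∘)(Y, Z)` of the product. -/
def covMul (D : AffConn n M) (c : MulField n M) (X Y Z : VField n M) : VField n M :=
  cov D X (mul c Y Z) - mul c (cov D X Y) Z - mul c Y (cov D X Z)

/-- The (smooth) connection `D` is compatible with the product `c`: it is torsionless,
`(∇_X ∘)(Y, Z) = (∇_Y ∘)(X, Z)`, and
`Z ∘ R(W, Y)(X) + W ∘ R(Y, Z)(X) + Y ∘ R(Z, W)(X) = 0`. -/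
structure IsCompatible (c : MulField n M) (D : AffConn n M) : Prop where
  smooth : D.ContMDiffCovariantDerivative ∞
  torsion_free : D.torsion = 0
  symm_covMul : ∀ (X Y Z : VField n M) (x : M),
    SmoothAt X x → SmoothAt Y x → SmoothAt Z x →
    covMul D c X Y Z x = covMul D c Y X Z x
  curv_mul : ∀ (X Y Z W : VField n M) (x : M),
    SmoothAt X x → SmoothAt Y x → SmoothAt Z x → SmoothAt W x →
    (mul c Z (curv D W Y X) + mul c W (curv D Y Z X) + mul c Y (curv D Z W X)) x = 0

/-- The exterior covariant derivative of a vector field, `(d_∇ X)(Y) = ∇_Y X`. -/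
def dVF (D : AffConn n M) (X : VField n M) : EndField n M :=
  fun x => D X x

/-- The exterior covariant derivative of a `TM`-valued one-form,
`(d_∇ V)(X, Y) = ∇_X (V Y) - ∇_Y (V X) - V [X, Y]`. -/
def dEnd (D : AffConn n M) (V : EndField n M) (X Y : VField n M) : VField n M :=
  cov D X (fun x => V x (Y x)) - cov D Y (fun x => V x (X x)) - fun x => V x (bracket X Y x)

/-- Two connections compatible with the same product `∘` are hydrodynamically equivalent if
`(d_∇ - d_∇') (X ∘) = 0` for every vector field `X`. -/
structure HydroEquivalent (c : MulField n M) (D D' : AffConn n M) : Prop where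
  left : IsCompatible c D
  right : IsCompatible c D'
  equiv : ∀ (X Y Z : VField n M) (x : M), SmoothAt X x → SmoothAt Y x → SmoothAt Z x →
    dEnd D (mulBy c X) Y Z x - dEnd D' (mulBy c X) Y Z x = 0

/-- The vector field `X` is smooth on `U` and solves `d_{∇₁} d_{∇₂} X = 0` there. -/
def IsSolutionOn (D₁ D₂ : AffConn n M) (U : Set M) (X : VField n M) : Prop :=
  SmoothOn X U ∧ ∀ x ∈ U, ∀ Y Z : VField n M, SmoothAt Y x → SmoothAt Z x →
    dEnd D₁ (dVF D₂ X) Y Z x = 0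

/-- The Lenard-Magri relation `d_{∇₁} X' = d_{∇₂} X` on `U`. -/
def LenardMagriOn (D₁ D₂ : AffConn n M) (U : Set M) (X X' : VField n M) : Prop :=
  ∀ x ∈ U, dVF D₁ X' x = dVF D₂ X x

/-- `d_∇ X` commutes on `U` with the endomorphism field `L`. -/
def CommutesOn (D : AffConn n M) (L : EndField n M) (U : Set M) (X : VField n M) : Prop :=
  ∀ x ∈ U, (dVF D X x).comp (L x) = (L x).comp (dVF D X x)

/-- `(X_1, …, X_n)` is a smooth frame on `U` of vector fields that are flat for `D`. -/
def IsFlatFrameOn (D : AffConn n M) (U : Set M) (X : Fin n → VField n M) : Prop :=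
  (∀ α, SmoothOn (X α) U) ∧ (∀ α, ∀ x ∈ U, dVF D (X α) x = 0) ∧
    ∀ x ∈ U, LinearIndependent ℝ (fun α => X α x)

end

end
end FMan
end

noncomputable section

namespace FMan

set_option maxSynthPendingDepth 3

/-! ### Radial homotopy operators on a finite-dimensional space -/

section Analysis

open MeasureTheory Set

variable {E F : Type*} [NormedAddCommGroup E] [NormedSpace ℝ E]
  [NormedAddCommGroup F] [NormedSpace ℝ F]

/-! Write `b = ∇⁽¹⁾_e e - ∇⁽²⁾_e e`. Hydrodynamic equivalence, together with the symmetry of `∇∘`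
for both connections, forces their difference to be a multiplication: `∇⁽¹⁾_Y X - ∇⁽²⁾_Y X = b ∘ X ∘
Y` (`HydroEquivalent.difference_eq`).

Since `∇⁽²⁾` is flat, `d_{∇⁽²⁾} d_{∇⁽²⁾} X = 0`, so `d_{∇⁽¹⁾} d_{∇⁽²⁾} X` evaluated on `(Y, Z)` is
the algebraic expression `b ∘ (∇⁽²⁾_Z X ∘ Y - ∇⁽²⁾_Y X ∘ Z)`. Replacing `∇⁽²⁾` by `∇⁽¹⁾` inside it
adds only a term symmetric in `Y` and `Z`, which cancels (`dEnd_dVF_eq'`). The equation is thus a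
condition on `d_{∇⁽²⁾} X`, and the same condition on `d_{∇⁽¹⁾} X`; the recursion, which equates
`d_{∇⁽¹⁾} X'` with `d_{∇⁽²⁾} X`, therefore preserves solutions. Moreover `d_{∇⁽²⁾} X` and `d_{∇⁽¹⁾}
X` differ by multiplication by `b ∘ X`, which commutes with `E ∘`, so commutation with `L`
propagates.

For existence, the equation says that `d_{∇⁽²⁾} X` is closed for `d_{∇⁽¹⁾}`. As `∇⁽¹⁾` is flat, it
has a parallel frame on a small coordinate ball; in that frame its covariant derivative is the
ordinary one and the Poincaré lemma gives `X'` (`exists_covariant_primitive`). The ball depends on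
`∇⁽¹⁾` only, so all steps of the recursion take place on one neighbourhood. The frame is built by
hand: Picard iteration with the radial homotopy operator, where zero curvature makes the failure of
the iterates to be parallel decay geometrically. Flat fields are solutions with `d_{∇⁽¹⁾} X = 0`,
hence start chains. -/

theorem hasFDerivAt_parametric_integral [FiniteDimensional ℝ E]
    {f : E → ℝ → F} {f' : E → ℝ → E →L[ℝ] F}
    (hf : Continuous (Function.uncurry f)) (hf' : Continuous (Function.uncurry f'))
    (h : ∀ x t, HasFDerivAt (fun y => f y t) (f' x t) x) (x : E) :
    HasFDerivAt (fun y => ∫ t in (0 : ℝ)..1, f y t) (∫ t in (0 : ℝ)..1, f' x t) x := by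
  have hK : IsCompact (Metric.closedBall x 1 ×ˢ Icc (0 : ℝ) 1) :=
    (isCompact_closedBall x 1).prod isCompact_Icc
  obtain ⟨C, hC⟩ := hK.exists_bound_of_continuousOn hf'.continuousOn
  refine (intervalIntegral.hasFDerivAt_integral_of_dominated_of_fderiv_le (bound := fun _ => C)
    (Metric.ball_mem_nhds x one_pos) ?_ ?_ ?_ ?_ ?_ ?_)
  · exact .of_forall fun y => (by fun_prop : Continuous (f y)).aestronglyMeasurable
  · exact (by fun_prop : Continuous (f x)).intervalIntegrable _ _
  · exact (by fun_prop : Continuous (f' x)).aestronglyMeasurable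
  · refine .of_forall fun t ht y hy => hC (y, t) ⟨Metric.ball_subset_closedBall hy, ?_⟩
    rw [uIoc_of_le zero_le_one] at ht
    exact Ioc_subset_Icc_self ht
  · exact intervalIntegrable_const
  · exact .of_forall fun t _ y _ => h y t

/-- The radial homotopy operator on one-forms. -/
def radialPrimitive (α : E → E →L[ℝ] F) (x : E) : F :=
  ∫ t in (0 : ℝ)..1, α (t • x) x

/-- The radial homotopy operator on two-forms, applied to the exterior derivative of `α`. -/
def radialDefect (α : E → E →L[ℝ] F) (x : E) : E →L[ℝ] F :=
  ∫ t in (0 : ℝ)..1, t • (fderiv ℝ α (t • x) x - (fderiv ℝ α (t • x)).flip x)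

theorem continuous_fderiv_smul {α : E → E →L[ℝ] F} (hα : ContDiff ℝ 1 α) :
    Continuous (fun p : E × ℝ => fderiv ℝ α (p.2 • p.1)) :=
  (hα.continuous_fderiv one_ne_zero).comp (by fun_prop)

/-- The homotopy formula `dK + Kd = id`. Differentiation under the integral gives `α (t x) + t (∂_•
α)(t x) x`, while `d/dt (t α (t x))` integrates to `α x`; the two integrands differ by the exterior
derivative contracted with `x`. -/
theorem hasFDerivAt_radialPrimitive [FiniteDimensional ℝ E] [CompleteSpace F]
    {α : E → E →L[ℝ] F} (hα : ContDiff ℝ 1 α) (x : E) :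
    HasFDerivAt (radialPrimitive α) (α x - radialDefect α x) x := by
  have hc : Continuous α := hα.continuous
  have hc' := continuous_fderiv_smul hα
  have hd : ∀ y, HasFDerivAt α (fderiv ℝ α y) y := fun y =>
    (hα.differentiable one_ne_zero y).hasFDerivAt
  have hflip : Continuous (fun p : E × ℝ => (fderiv ℝ α (p.2 • p.1)).flip p.1) :=
    ((ContinuousLinearMap.flipₗᵢ ℝ E E F).continuous.comp hc').clm_apply continuous_fst
  have h1 := hasFDerivAt_parametric_integral
    (f := fun y t => α (t • y) y)
    (f' := fun y t => α (t • y) + t • (fderiv ℝ α (t • y)).flip y)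
    (by fun_prop)
    ((hc.comp (by fun_prop)).add (continuous_snd.smul hflip))
    (fun y t => by
      have := ((hd (t • y)).comp y ((hasFDerivAt_id y).const_smul t)).clm_apply (hasFDerivAt_id y)
      convert! this using 1
      ext v
      simp) x
  have hx : Continuous (fun t : ℝ => fderiv ℝ α (t • x)) :=
    hc'.comp (by fun_prop : Continuous fun t : ℝ => (x, t))
  have hx' : Continuous (fun t : ℝ => (fderiv ℝ α (t • x)).flip x) :=
    hflip.comp (by fun_prop : Continuous fun t : ℝ => (x, t))
  have h2 : ∫ t in (0 : ℝ)..1, (α (t • x) + t • fderiv ℝ α (t • x) x) = α x := by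
    have := intervalIntegral.integral_eq_sub_of_hasDerivAt (a := 0) (b := 1)
      (f := fun t : ℝ => t • α (t • x))
      (f' := fun t => α (t • x) + t • fderiv ℝ α (t • x) x) ?_ ?_
    · simpa using this
    · intro t _
      have h3 : HasDerivAt (fun t : ℝ => t • x) x t := by
        simpa using (hasDerivAt_id t).smul_const x
      have h4 := (hasDerivAt_id t).smul ((hd (t • x)).comp_hasDerivAt t h3)
      convert! h4 using 1
      simp [add_comm]
    · exact Continuous.intervalIntegrable (by fun_prop) _ _
  convert! h1 using 1
  rw [radialDefect, ← h2, ← intervalIntegral.integral_sub]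
  · congr 1
    ext1 t
    rw [smul_sub]
    abel
  · exact Continuous.intervalIntegrable (by fun_prop) _ _
  · exact Continuous.intervalIntegrable (by fun_prop) _ _

theorem contDiff_radialPrimitive [FiniteDimensional ℝ E] [CompleteSpace F]
    {α : E → E →L[ℝ] F} (hα : ContDiff ℝ 1 α) :
    ContDiff ℝ 1 (radialPrimitive α) := by
  rw [contDiff_one_iff_hasFDerivAt]
  refine ⟨_, ?_, hasFDerivAt_radialPrimitive hα⟩
  have hc' := continuous_fderiv_smul hα
  have hflip : Continuous (fun p : E × ℝ => (fderiv ℝ α (p.2 • p.1)).flip p.1) :=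
    ((ContinuousLinearMap.flipₗᵢ ℝ E E F).continuous.comp hc').clm_apply continuous_fst
  refine hα.continuous.sub ?_
  exact intervalIntegral.continuous_parametric_intervalIntegral_of_continuous'
    (f := fun x t => t • (fderiv ℝ α (t • x) x - (fderiv ℝ α (t • x)).flip x))
    (continuous_snd.smul ((hc'.clm_apply continuous_fst).sub hflip)) 0 1

theorem norm_radialPrimitive_le {α : E → E →L[ℝ] F} {r A : ℝ} {x : E}
    (h : ∀ y ∈ Metric.ball (0 : E) r, ‖α y‖ ≤ A) (hx : x ∈ Metric.ball (0 : E) r) :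
    ‖radialPrimitive α x‖ ≤ A * r := by
  have hx' : ‖x‖ < r := by simpa using hx
  have hA : 0 ≤ A := (norm_nonneg _).trans (h x hx)
  refine (intervalIntegral.norm_integral_le_of_norm_le_const (C := A * r) fun t ht => ?_).trans
    (by simp)
  rw [uIoc_of_le zero_le_one] at ht
  have htx : t • x ∈ Metric.ball (0 : E) r := by
    rw [mem_ball_zero_iff, norm_smul, Real.norm_of_nonneg ht.1.le]
    nlinarith [norm_nonneg x, ht.2]
  refine ((α (t • x)).le_opNorm x).trans ?_
  gcongr
  exact h _ htx

theorem norm_radialDefect_le {α : E → E →L[ℝ] F} {r A : ℝ} {x : E} (hA : 0 ≤ A)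
    (h : ∀ y ∈ Metric.ball (0 : E) r, ∀ u v,
      ‖fderiv ℝ α y u v - fderiv ℝ α y v u‖ ≤ A * ‖u‖ * ‖v‖) (hx : x ∈ Metric.ball (0 : E) r) :
    ‖radialDefect α x‖ ≤ A * r := by
  have hx' : ‖x‖ < r := by simpa using hx
  have hr : 0 ≤ r := (norm_nonneg x).trans hx'.le
  refine (intervalIntegral.norm_integral_le_of_norm_le_const (C := A * r) fun t ht => ?_).trans
    (by simp)
  rw [uIoc_of_le zero_le_one] at ht
  have htx : t • x ∈ Metric.ball (0 : E) r := by
    rw [mem_ball_zero_iff, norm_smul, Real.norm_of_nonneg ht.1.le]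
    nlinarith [norm_nonneg x, ht.2]
  have h1 : ‖fderiv ℝ α (t • x) x - (fderiv ℝ α (t • x)).flip x‖ ≤ A * r := by
    refine ContinuousLinearMap.opNorm_le_bound _ (by positivity) fun v => ?_
    refine (h _ htx x v).trans ?_
    gcongr
  rw [norm_smul, Real.norm_of_nonneg ht.1.le]
  nlinarith [norm_nonneg (fderiv ℝ α (t • x) x - (fderiv ℝ α (t • x)).flip x), ht.2]

/-! ### Picard iteration for radial parallel transport -/

variable (E F) in
/-- Exchanging the arguments of a bilinear map, as a continuous linear map. -/
def flipCLM : (E →L[ℝ] F →L[ℝ] F) →L[ℝ] (F →L[ℝ] E →L[ℝ] F) :=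
  (ContinuousLinearMap.flipₗᵢ ℝ E F F).toContinuousLinearEquiv

theorem flipCLM_apply (B : E →L[ℝ] F →L[ℝ] F) : flipCLM E F B = B.flip := rfl

/-- The Picard iterates for the radial parallel transport of the connection form `Γ`. -/
def picardIterate (Γ : E → E →L[ℝ] F →L[ℝ] F) (s₀ : F) : ℕ → E → F
  | 0 => fun _ => s₀
  | k + 1 => fun x => s₀ - radialPrimitive (fun y => (Γ y).flip (picardIterate Γ s₀ k y)) x

theorem contDiff_flip_apply {Γ : E → E →L[ℝ] F →L[ℝ] F} {s : E → F} {m : WithTop ℕ∞}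
    (hΓ : ContDiff ℝ m Γ) (hs : ContDiff ℝ m s) :
    ContDiff ℝ m (fun y => (Γ y).flip (s y)) := by
  simp only [← flipCLM_apply]
  have h : ContDiff ℝ m (flipCLM E F) := ContinuousLinearMap.contDiff _
  exact (h.comp hΓ).clm_apply hs

theorem contDiff_picardIterate [FiniteDimensional ℝ E] [CompleteSpace F]
    {Γ : E → E →L[ℝ] F →L[ℝ] F} (hΓ : ContDiff ℝ 1 Γ) (s₀ : F) (k : ℕ) :
    ContDiff ℝ 1 (picardIterate Γ s₀ k) := by
  induction k with
  | zero => exact contDiff_const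
  | succ k ih => exact contDiff_const.sub (contDiff_radialPrimitive (contDiff_flip_apply hΓ ih))

theorem picardIterate_zero (Γ : E → E →L[ℝ] F →L[ℝ] F) (s₀ : F) (k : ℕ) :
    picardIterate Γ s₀ k 0 = s₀ := by
  cases k <;> simp [picardIterate, radialPrimitive]

/-- A connection form with vanishing curvature. -/
def CurvatureZeroOn (Γ : E → E →L[ℝ] F →L[ℝ] F) (U : Set E) : Prop :=
  ∀ y ∈ U, ∀ u v w, fderiv ℝ Γ y u v w - fderiv ℝ Γ y v u w
    + (Γ y u (Γ y v w) - Γ y v (Γ y u w)) = 0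

theorem fderiv_flip_apply {Γ : E → E →L[ℝ] F →L[ℝ] F} {s : E → F} {y : E}
    (hΓ : ContDiff ℝ 1 Γ) (hs : ContDiff ℝ 1 s) (u v : E) :
    fderiv ℝ (fun y => (Γ y).flip (s y)) y u v
      = fderiv ℝ Γ y u v (s y) + Γ y v (fderiv ℝ s y u) := by
  have hα : DifferentiableAt ℝ (fun y => (Γ y).flip (s y)) y :=
    (contDiff_flip_apply hΓ hs).differentiable one_ne_zero y
  replace hΓ := hΓ.differentiable one_ne_zero y
  replace hs := hs.differentiable one_ne_zero y
  have h1 := hα.hasFDerivAt.clm_apply (hasFDerivAt_const v y)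
  have h2 := (hΓ.hasFDerivAt.clm_apply (hasFDerivAt_const v y)).clm_apply hs.hasFDerivAt
  have h3 := congrArg (fun T => T u) (h1.unique h2)
  simpa [add_comm] using h3

/-- One step contracts by `C * r ≤ 1 / 8`; the ratio `1 / 4` leaves slack. -/
theorem norm_picardIterate_sub_le [FiniteDimensional ℝ E] [CompleteSpace F]
    {Γ : E → E →L[ℝ] F →L[ℝ] F} (hΓ : ContDiff ℝ 1 Γ) (s₀ : F)
    {r C : ℝ} (hC : ∀ y ∈ Metric.ball (0 : E) r, ‖Γ y‖ ≤ C) (hr : C * r ≤ 1 / 8)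
    (k : ℕ) : ∀ x ∈ Metric.ball (0 : E) r,
    ‖picardIterate Γ s₀ (k + 1) x - picardIterate Γ s₀ k x‖ ≤ ‖s₀‖ * (1 / 4) ^ k := by
  induction k with
  | zero =>
    intro x hx
    have h := norm_radialPrimitive_le (α := fun y => (Γ y).flip s₀) (A := C * ‖s₀‖) (r := r)
      (fun y hy => ?_) hx
    · simp only [picardIterate, sub_sub_cancel_left, norm_neg, pow_zero, mul_one]
      nlinarith [norm_nonneg s₀]
    · refine ((Γ y).flip.le_opNorm s₀).trans ?_
      rw [ContinuousLinearMap.opNorm_flip]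
      gcongr
      exact hC y hy
  | succ k ih =>
    intro x hx
    have hint : ∀ j, IntervalIntegrable
        (fun t : ℝ => (Γ (t • x)).flip (picardIterate Γ s₀ j (t • x)) x) volume 0 1 := fun j => by
      refine Continuous.intervalIntegrable ?_ _ _
      have := (contDiff_flip_apply hΓ (contDiff_picardIterate hΓ s₀ j)).continuous
      exact (this.comp (by fun_prop : Continuous fun t : ℝ => t • x)).clm_apply continuous_const
    have h := norm_radialPrimitive_le
      (α := fun y => (Γ y).flip (picardIterate Γ s₀ (k + 1) y - picardIterate Γ s₀ k y))
      (A := C * (‖s₀‖ * (1 / 4) ^ k)) (r := r) (fun y hy => ?_) hx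
    · have heq : picardIterate Γ s₀ (k + 1 + 1) x - picardIterate Γ s₀ (k + 1) x
          = - radialPrimitive
            (fun y => (Γ y).flip (picardIterate Γ s₀ (k + 1) y - picardIterate Γ s₀ k y)) x := by
        change (s₀ - radialPrimitive (fun y => (Γ y).flip (picardIterate Γ s₀ (k + 1) y)) x)
          - (s₀ - radialPrimitive (fun y => (Γ y).flip (picardIterate Γ s₀ k y)) x) = _
        rw [sub_sub_sub_cancel_left, ← neg_sub, neg_inj]
        refine (intervalIntegral.integral_sub (hint _) (hint _)).symm.trans ?_
        simp only [radialPrimitive, map_sub, sub_apply]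
      rw [heq, norm_neg]
      refine h.trans ?_
      have : 0 ≤ ‖s₀‖ * (1 / 4) ^ k := by positivity
      rw [pow_succ]
      nlinarith
    · refine ((Γ y).flip.le_opNorm _).trans ?_
      rw [ContinuousLinearMap.opNorm_flip]
      have : 0 ≤ C := (norm_nonneg (Γ y)).trans (hC y hy)
      gcongr
      · exact hC y hy
      · exact ih y hy

/-- The quantity bounded is the covariant derivative `P` of the iterate. Zero curvature turns the
exterior derivative of `Γ s` into `Γ_v (P u) - Γ_u (P v)`, so the defect in the homotopy formula is
controlled by `P` itself and the estimate is recursive. -/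
theorem norm_fderiv_picardIterate_add_le [FiniteDimensional ℝ E] [CompleteSpace F]
    {Γ : E → E →L[ℝ] F →L[ℝ] F} (hΓ : ContDiff ℝ 1 Γ) (s₀ : F)
    {r C : ℝ} (hC0 : 0 ≤ C) (hC : ∀ y ∈ Metric.ball (0 : E) r, ‖Γ y‖ ≤ C) (hr : C * r ≤ 1 / 8)
    (hcurv : CurvatureZeroOn Γ (Metric.ball 0 r))
    (k : ℕ) : ∀ x ∈ Metric.ball (0 : E) r,
    ‖fderiv ℝ (picardIterate Γ s₀ k) x + (Γ x).flip (picardIterate Γ s₀ k x)‖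
      ≤ 4 * C * ‖s₀‖ * (1 / 2) ^ k := by
  induction k with
  | zero =>
    intro x hx
    have h : fderiv ℝ (picardIterate Γ s₀ 0) x = 0 := by
      simp [picardIterate]
    rw [h, zero_add]
    refine ((Γ x).flip.le_opNorm _).trans ?_
    rw [ContinuousLinearMap.opNorm_flip]
    simp only [picardIterate, pow_zero, mul_one]
    have := hC x hx
    nlinarith [norm_nonneg s₀, mul_nonneg hC0 (norm_nonneg s₀)]
  | succ k ih =>
    intro x hx
    set s := picardIterate Γ s₀ k with hs
    have hsd : ContDiff ℝ 1 s := contDiff_picardIterate hΓ s₀ k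
    set α : E → E →L[ℝ] F := fun y => (Γ y).flip (s y) with hα
    have hαd : ContDiff ℝ 1 α := contDiff_flip_apply hΓ hsd
    have hder : fderiv ℝ (picardIterate Γ s₀ (k + 1)) x = - (α x - radialDefect α x) := by
      have := (hasFDerivAt_radialPrimitive hαd x).const_sub s₀
      exact this.fderiv
    have hdef : ‖radialDefect α x‖ ≤ (2 * C * (4 * C * ‖s₀‖ * (1 / 2) ^ k)) * r := by
      refine norm_radialDefect_le (by positivity) (fun y hy u v => ?_) hx
      rw [hα, fderiv_flip_apply hΓ hsd, fderiv_flip_apply hΓ hsd]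
      set P := fderiv ℝ s y + (Γ y).flip (s y) with hP
      have hPb : ∀ w, ‖P w‖ ≤ 4 * C * ‖s₀‖ * (1 / 2) ^ k * ‖w‖ := fun w =>
        P.le_of_opNorm_le (ih y hy) w
      have hG : ∀ a w, ‖Γ y a w‖ ≤ C * ‖a‖ * ‖w‖ := fun a w =>
        ((Γ y).le_opNorm₂ a w).trans (by gcongr; exact hC y hy)
      have e : fderiv ℝ Γ y u v (s y) + Γ y v (fderiv ℝ s y u)
          - (fderiv ℝ Γ y v u (s y) + Γ y u (fderiv ℝ s y v)) = Γ y v (P u) - Γ y u (P v) := by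
        have := hcurv y hy u v (s y)
        simp only [hP, add_apply, ContinuousLinearMap.flip_apply, map_add]
        rw [← sub_eq_zero, ← this]
        abel
      rw [e]
      refine (norm_sub_le _ _).trans ?_
      have h1 := (hG v (P u)).trans (mul_le_mul_of_nonneg_left (hPb u) (by positivity))
      have h2 := (hG u (P v)).trans (mul_le_mul_of_nonneg_left (hPb v) (by positivity))
      nlinarith
    rw [hder]
    have e2 : -(α x - radialDefect α x) + (Γ x).flip (picardIterate Γ s₀ (k + 1) x)
        = radialDefect α x + (Γ x).flip (picardIterate Γ s₀ (k + 1) x - s x) := by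
      rw [map_sub]
      simp only [hα]
      abel
    rw [e2]
    refine (norm_add_le _ _).trans ?_
    have h3 : ‖(Γ x).flip (picardIterate Γ s₀ (k + 1) x - s x)‖ ≤ C * (‖s₀‖ * (1 / 4) ^ k) := by
      refine ((Γ x).flip.le_opNorm _).trans ?_
      rw [ContinuousLinearMap.opNorm_flip]
      gcongr
      · exact hC x hx
      · exact norm_picardIterate_sub_le hΓ s₀ hC hr k x hx
    have h4 : ((1 : ℝ) / 4) ^ k ≤ (1 / 2) ^ k := by gcongr; norm_num
    have h5 : 0 ≤ C * ‖s₀‖ := by positivity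
    have h6 : 0 ≤ C * ‖s₀‖ * (1 / 2) ^ k := by positivity
    rw [pow_succ]
    -- The defect costs a factor `2 * C * r ≤ 1 / 4`, giving `C‖s₀‖ (1/2)^k`; the difference of
    -- iterates gives at most the same again. The sum is `4C‖s₀‖ (1/2)^(k+1)`, whence the constant
    -- 4.
    nlinarith [mul_le_mul_of_nonneg_left h4 h5, mul_le_mul_of_nonneg_left hr h6]

/-- A flat `C¹` connection form has parallel sections with given value at the origin, on small
balls. -/
theorem exists_parallel_section_of_contDiff [FiniteDimensional ℝ E] [CompleteSpace F]
    {Γ : E → E →L[ℝ] F →L[ℝ] F} (hΓ : ContDiff ℝ 1 Γ)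
    (s₀ : F) {r C : ℝ} (hr0 : 0 < r) (hC0 : 0 ≤ C)
    (hC : ∀ y ∈ Metric.ball (0 : E) r, ‖Γ y‖ ≤ C)
    (hr : C * r ≤ 1 / 8) (hcurv : CurvatureZeroOn Γ (Metric.ball 0 r)) :
    ∃ s : E → F, s 0 = s₀ ∧
      ∀ x ∈ Metric.ball (0 : E) r, HasFDerivAt s (-(Γ x).flip (s x)) x := by
  have hdist : ∀ x ∈ Metric.ball (0 : E) r, ∀ k,
      dist (picardIterate Γ s₀ k x) (picardIterate Γ s₀ (k + 1) x) ≤ ‖s₀‖ * (1 / 4) ^ k :=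
    fun x hx k => by
      rw [dist_comm, dist_eq_norm]
      exact norm_picardIterate_sub_le hΓ s₀ hC hr k x hx
  -- The limit matters only on the ball; the value 0 elsewhere is a default.
  have hlim : ∀ x, ∃ l, x ∈ Metric.ball (0 : E) r →
      Filter.Tendsto (fun k => picardIterate Γ s₀ k x) Filter.atTop (𝓝 l) := fun x => by
    by_cases hx : x ∈ Metric.ball (0 : E) r
    · obtain ⟨l, hl⟩ := cauchySeq_tendsto_of_complete
        (cauchySeq_of_le_geometric (1 / 4) ‖s₀‖ (by norm_num) (hdist x hx))
      exact ⟨l, fun _ => hl⟩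
    · exact ⟨0, fun h => absurd h hx⟩
  choose s hs using hlim
  have hsdist : ∀ x ∈ Metric.ball (0 : E) r, ∀ k,
      ‖picardIterate Γ s₀ k x - s x‖ ≤ ‖s₀‖ * (1 / 4) ^ k / (1 - 1 / 4) := fun x hx k => by
    rw [← dist_eq_norm]
    exact dist_le_of_le_geometric_of_tendsto (1 / 4) ‖s₀‖ (by norm_num) (hdist x hx) (hs x hx) k
  refine ⟨s, ?_, fun x hx => ?_⟩
  · refine tendsto_nhds_unique (hs 0 (by simpa using hr0)) ?_
    simp only [picardIterate_zero]
    exact tendsto_const_nhds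
  -- The derivative of an iterate is its covariant derivative, tending uniformly to 0, minus `Γ`
  -- applied to the iterate; hence derivatives converge uniformly to `-Γ s`.
  · refine hasFDerivAt_of_tendstoUniformlyOn Metric.isOpen_ball
      (f := picardIterate Γ s₀) (f' := fun k => fderiv ℝ (picardIterate Γ s₀ k))
      (g' := fun x => -(Γ x).flip (s x)) (l := Filter.atTop) ?_
      (fun k y _ => ((contDiff_picardIterate hΓ s₀ k).differentiable one_ne_zero y).hasFDerivAt)
      (fun y hy => hs y hy) hx
    rw [Metric.tendstoUniformlyOn_iff]
    intro ε hε
    have ht : Filter.Tendsto (fun k : ℕ => 4 * C * ‖s₀‖ * (1 / 2) ^ k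
        + C * (‖s₀‖ * (1 / 4) ^ k / (1 - 1 / 4))) Filter.atTop (𝓝 0) := by
      have h1 := (tendsto_pow_atTop_nhds_zero_of_lt_one (r := (1 / 2 : ℝ)) (by norm_num)
        (by norm_num)).const_mul (4 * C * ‖s₀‖)
      have h2 := (((tendsto_pow_atTop_nhds_zero_of_lt_one (r := (1 / 4 : ℝ)) (by norm_num)
        (by norm_num)).const_mul ‖s₀‖).div_const (1 - 1 / 4)).const_mul C
      simpa using h1.add h2
    filter_upwards [ht.eventually (gt_mem_nhds hε)] with k hk y hy
    refine lt_of_le_of_lt ?_ hk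
    rw [dist_comm, dist_eq_norm, sub_neg_eq_add]
    have e : fderiv ℝ (picardIterate Γ s₀ k) y + (Γ y).flip (s y)
        = (fderiv ℝ (picardIterate Γ s₀ k) y + (Γ y).flip (picardIterate Γ s₀ k y))
          - (Γ y).flip (picardIterate Γ s₀ k y - s y) := by
      rw [map_sub]; abel
    rw [e]
    refine (norm_sub_le _ _).trans (add_le_add
      (norm_fderiv_picardIterate_add_le hΓ s₀ hC0 hC hr hcurv k y hy) ?_)
    refine ((Γ y).flip.le_opNorm _).trans ?_
    rw [ContinuousLinearMap.opNorm_flip]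
    gcongr
    · exact hC y hy
    · exact hsdist y hy k

/-! ### Smooth parallel frames and the covariant Poincaré lemma -/

theorem contDiffOn_flip_apply {Γ : E → E →L[ℝ] F →L[ℝ] F} {s : E → F} {m : WithTop ℕ∞}
    {B : Set E} (hΓ : ContDiffOn ℝ m Γ B) (hs : ContDiffOn ℝ m s B) :
    ContDiffOn ℝ m (fun y => (Γ y).flip (s y)) B := by
  simp only [← flipCLM_apply]
  have h : ContDiff ℝ m (flipCLM E F) := ContinuousLinearMap.contDiff _
  exact (h.comp_contDiffOn hΓ).clm_apply hs

/-- Bootstrapping: the equation expresses the derivative of `s` through `s`, so each order of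
smoothness yields the next. -/
theorem contDiffOn_of_parallel {Γ : E → E →L[ℝ] F →L[ℝ] F} {s : E → F} {B : Set E}
    (hB : IsOpen B) (hΓ : ContDiffOn ℝ ∞ Γ B)
    (hs : ∀ x ∈ B, HasFDerivAt s (-(Γ x).flip (s x)) x) : ContDiffOn ℝ ∞ s B := by
  have hd : DifferentiableOn ℝ s B := fun x hx => (hs x hx).differentiableAt.differentiableWithinAt
  rw [contDiffOn_infty]
  intro k
  induction k with
  | zero =>
    rw [Nat.cast_zero, contDiffOn_zero]
    exact hd.continuousOn
  | succ k ih =>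
    rw [Nat.cast_succ, contDiffOn_succ_iff_fderiv_of_isOpen hB]
    refine ⟨hd, fun h => absurd h (by simp), ?_⟩
    have h1 := (contDiffOn_flip_apply (hΓ.of_le (by exact_mod_cast le_top)) ih).neg
    exact h1.congr fun x hx => (hs x hx).fderiv

/-- The connection form induced on endomorphisms by left composition. -/
def leftCompForm (Γ : E → E →L[ℝ] F →L[ℝ] F) (y : E) : E →L[ℝ] (F →L[ℝ] F) →L[ℝ] (F →L[ℝ] F) :=
  (ContinuousLinearMap.compL ℝ F F F).comp (Γ y)

theorem contDiffOn_leftCompForm {Γ : E → E →L[ℝ] F →L[ℝ] F} {U : Set E}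
    (hΓ : ContDiffOn ℝ ∞ Γ U) : ContDiffOn ℝ ∞ (leftCompForm Γ) U :=
  contDiffOn_const.clm_comp hΓ

theorem curvatureZeroOn_leftCompForm {Γ : E → E →L[ℝ] F →L[ℝ] F} {U : Set E} (hU : IsOpen U)
    (hΓ : ContDiffOn ℝ ∞ Γ U) (hcurv : CurvatureZeroOn Γ U) :
    CurvatureZeroOn (leftCompForm Γ) U := by
  intro y hy u v w
  have hd : DifferentiableAt ℝ Γ y :=
    (hΓ.differentiableOn (by simp)).differentiableAt (hU.mem_nhds hy)
  have hf : ∀ u v : E, fderiv ℝ (leftCompForm Γ) y u v w = (fderiv ℝ Γ y u v).comp w := fun u v => by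
    have h1 : HasFDerivAt (leftCompForm Γ) _ y :=
      (hasFDerivAt_const (ContinuousLinearMap.compL ℝ F F F) y).clm_comp hd.hasFDerivAt
    rw [h1.fderiv]
    simp
  rw [hf, hf]
  ext a
  simpa [leftCompForm] using hcurv y hy u v (w a)

variable [CompleteSpace F]

theorem exists_parallel_section [FiniteDimensional ℝ E]
    {Γ : E → E →L[ℝ] F →L[ℝ] F} {U : Set E} (hU : IsOpen U)
    (hΓ : ContDiffOn ℝ ∞ Γ U) (hcurv : CurvatureZeroOn Γ U) {p : E} (hp : p ∈ U) (s₀ : F) :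
    ∃ r > 0, Metric.ball p r ⊆ U ∧ ∃ s : E → F, s p = s₀ ∧
      ∀ x ∈ Metric.ball p r, HasFDerivAt s (-(Γ x).flip (s x)) x := by
  obtain ⟨R, hR, hRU⟩ := Metric.nhds_basis_closedBall.mem_iff.1 (hU.mem_nhds hp)
  -- The radial estimates need a globally `C¹` form; cutting off leaves `Γ` unchanged on the ball of
  -- radius `R / 2`.
  let f : ContDiffBump p := ⟨R / 2, R, by positivity, by linarith⟩
  set Γ₁ : E → E →L[ℝ] F →L[ℝ] F := fun x => f x • Γ x with hΓ₁
  have h₁ : ContDiff ℝ 1 Γ₁ := by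
    rw [contDiff_iff_contDiffAt]
    intro x
    by_cases hx : x ∈ U
    · exact f.contDiff.contDiffAt.smul
        ((hΓ.contDiffAt (hU.mem_nhds hx)).of_le (by exact_mod_cast le_top))
    · have hx' : x ∉ tsupport f := by
        rw [f.tsupport_eq]
        exact fun h => hx (hRU h)
      have h0 : Γ₁ =ᶠ[𝓝 x] fun _ => 0 := by
        filter_upwards [notMem_tsupport_iff_eventuallyEq.1 hx'] with y hy
        simp [hΓ₁, hy]
      exact contDiffAt_const.congr_of_eventuallyEq h0
  have heq : ∀ x ∈ Metric.ball p (R / 2), Γ₁ x = Γ x := fun x hx => by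
    simp only [hΓ₁]
    rw [f.one_of_mem_closedBall (Metric.ball_subset_closedBall hx), one_smul]
  have hbU : Metric.ball p (R / 2) ⊆ U := fun x hx =>
    hRU (Metric.ball_subset_closedBall (Metric.ball_subset_ball (by linarith) hx))
  set Γ₂ : E → E →L[ℝ] F →L[ℝ] F := fun y => Γ₁ (p + y) with hΓ₂
  have h₂ : ContDiff ℝ 1 Γ₂ := h₁.comp (contDiff_const.add contDiff_id)
  obtain ⟨δ, hδ, hδb⟩ : ∃ δ > 0, ∀ y ∈ Metric.ball (0 : E) δ, ‖Γ₂ y‖ ≤ ‖Γ₂ 0‖ + 1 := by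
    have := (h₂.continuous.norm.continuousAt (x := 0)).eventually (gt_mem_nhds (lt_add_one ‖Γ₂ 0‖))
    obtain ⟨δ, hδ, h⟩ := Metric.eventually_nhds_iff_ball.1 this
    exact ⟨δ, hδ, fun y hy => (h y hy).le⟩
  set C := ‖Γ₂ 0‖ + 1 with hC
  have hCpos : 0 < C := by positivity
  -- `δ` secures the bound `C`, `R / 2` avoids the region altered by the cutoff, and `1 / (8 * C)`
  -- makes the iteration contract.
  set r := min (min δ (R / 2)) (1 / (8 * C)) with hr
  have hr0 : 0 < r := by positivity
  have hrR : r ≤ R / 2 := (min_le_left _ _).trans (min_le_right _ _)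
  have hrδ : r ≤ δ := (min_le_left _ _).trans (min_le_left _ _)
  have hrC : C * r ≤ 1 / 8 := by
    have : r ≤ 1 / (8 * C) := min_le_right _ _
    rw [le_div_iff₀ (by positivity)] at this
    linarith
  have hmem : ∀ y ∈ Metric.ball (0 : E) r, p + y ∈ Metric.ball p (R / 2) := fun y hy => by
    rw [mem_ball_iff_norm, add_sub_cancel_left]
    exact (mem_ball_zero_iff.1 hy).trans_le hrR
  have hcurv₂ : CurvatureZeroOn Γ₂ (Metric.ball 0 r) := by
    intro y hy u v w
    have hy' := hmem y hy
    have hder : fderiv ℝ Γ₂ y = fderiv ℝ Γ (p + y) := by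
      rw [hΓ₂, fderiv_comp_add_left]
      refine Filter.EventuallyEq.fderiv_eq ?_
      filter_upwards [Metric.isOpen_ball.mem_nhds hy'] with x hx using heq x hx
    rw [hder, hΓ₂]
    simp only [heq _ hy']
    exact hcurv _ (hbU hy') u v w
  obtain ⟨s, hs0, hs⟩ := exists_parallel_section_of_contDiff h₂ s₀ hr0 hCpos.le
    (fun y hy => hδb y (Metric.ball_subset_ball hrδ hy)) hrC hcurv₂
  refine ⟨r, hr0, (Metric.ball_subset_ball hrR).trans hbU, fun x => s (x - p), by simpa, ?_⟩
  intro x hx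
  have hx0 : x - p ∈ Metric.ball (0 : E) r := by
    rwa [mem_ball_zero_iff, ← mem_ball_iff_norm]
  have h3 := (hs _ hx0)
  have h4 : HasFDerivAt (fun x => s (x - p)) (-(Γ₂ (x - p)).flip (s (x - p))) x := by
    simpa [Function.comp_def] using h3.comp x ((hasFDerivAt_id x).sub_const p)
  have h5 : Γ₂ (x - p) = Γ x := by
    simp only [hΓ₂, add_sub_cancel]
    exact heq x (Metric.ball_subset_ball hrR hx)
  rwa [h5] at h4

/-- A flat connection form has an invertible matrix of parallel sections around every point. -/
theorem exists_parallel_frame [FiniteDimensional ℝ E]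
    {Γ : E → E →L[ℝ] F →L[ℝ] F} {U : Set E} (hU : IsOpen U)
    (hΓ : ContDiffOn ℝ ∞ Γ U) (hcurv : CurvatureZeroOn Γ U) {p : E} (hp : p ∈ U) :
    ∃ r > 0, Metric.ball p r ⊆ U ∧ ∃ G : E → F →L[ℝ] F, ContDiffOn ℝ ∞ G (Metric.ball p r) ∧
      (∀ x ∈ Metric.ball p r, IsUnit (G x)) ∧
      ∀ x ∈ Metric.ball p r, ∀ u, fderiv ℝ G x u = -(Γ x u).comp (G x) := by
  -- One parallel section of the endomorphism bundle, equal to the identity at `p`, contains all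
  -- parallel sections at once. It stays invertible nearby because units are open.
  obtain ⟨r, hr, hrU, G, hG0, hG⟩ := exists_parallel_section hU (contDiffOn_leftCompForm hΓ)
    (curvatureZeroOn_leftCompForm hU hΓ hcurv) hp (1 : F →L[ℝ] F)
  have hunit : ∀ᶠ x in 𝓝 p, IsUnit (G x) := by
    have hc : ContinuousAt G p := (hG p (Metric.mem_ball_self hr)).continuousAt
    refine hc.eventually ?_
    rw [hG0]
    exact Units.isOpen.mem_nhds isUnit_one
  obtain ⟨δ, hδ, hδu⟩ := Metric.eventually_nhds_iff_ball.1 hunit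
  have hsub : Metric.ball p (min r δ) ⊆ Metric.ball p r := Metric.ball_subset_ball (min_le_left _ _)
  refine ⟨min r δ, by positivity, hsub.trans hrU, G, ?_,
    fun x hx => hδu x (Metric.ball_subset_ball (min_le_right _ _) hx), fun x hx u => ?_⟩
  · exact (contDiffOn_of_parallel Metric.isOpen_ball
      ((contDiffOn_leftCompForm hΓ).mono hrU) hG).mono hsub
  · rw [(hG x (hsub hx)).fderiv]
    simp [leftCompForm]

/-- The covariant Poincaré lemma: on a convex open set with an invertible matrix `G` of parallel
sections, covariantly closed one-forms are covariantly exact. -/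
theorem exists_covariant_primitive {Γ : E → E →L[ℝ] F →L[ℝ] F} {B : Set E} (hB : IsOpen B)
    (hBc : Convex ℝ B) {G : E → F →L[ℝ] F} (hG : ContDiffOn ℝ ∞ G B)
    (hGu : ∀ x ∈ B, IsUnit (G x)) (hGd : ∀ x ∈ B, ∀ u, fderiv ℝ G x u = -(Γ x u).comp (G x))
    {α : E → E →L[ℝ] F} (hα : ContDiffOn ℝ ∞ α B)
    (hαc : ∀ x ∈ B, ∀ u v, fderiv ℝ α x u v + Γ x u (α x v)
      - (fderiv ℝ α x v u + Γ x v (α x u)) = 0) :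
    ∃ f : E → F, ContDiffOn ℝ ∞ f B ∧ ∀ x ∈ B, ∀ u, fderiv ℝ f x u + Γ x u (f x) = α x u := by
  have hinv : ContDiffOn ℝ ∞ (fun x => Ring.inverse (G x)) B := fun x hx => by
    obtain ⟨g, hg⟩ := hGu x hx
    have h1 : ContDiffAt ℝ ∞ (Ring.inverse : (F →L[ℝ] F) → _) (G x) := by
      rw [← hg]; exact contDiffAt_ringInverse ℝ g
    exact h1.comp_contDiffWithinAt x (hG x hx)
  -- With `α = G β` the covariant derivative becomes `G dβ`, so `β` is closed in the ordinary sense;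
  -- if `β = dh`, then `G h` is the primitive sought.
  set β : E → E →L[ℝ] F := fun x => (Ring.inverse (G x)).comp (α x) with hβ
  have hβs : ContDiffOn ℝ ∞ β B := hinv.clm_comp hα
  have hGβ : ∀ x ∈ B, ∀ v, G x (β x v) = α x v := fun x hx v => by
    have := Ring.mul_inverse_cancel (G x) (hGu x hx)
    exact congrArg (fun T : F →L[ℝ] F => T (α x v)) this
  have hdiff : ∀ {H : Type _} [NormedAddCommGroup H] [NormedSpace ℝ H] {f : E → H},
      ContDiffOn ℝ ∞ f B → ∀ x ∈ B, HasFDerivAt f (fderiv ℝ f x) x := fun hf x hx =>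
    ((hf.differentiableOn (by simp)).differentiableAt (hB.mem_nhds hx)).hasFDerivAt
  have hGd' : ∀ x ∈ B, HasFDerivAt G (fderiv ℝ G x) x := fun x hx =>
    ((hG.differentiableOn (by simp)).differentiableAt (hB.mem_nhds hx)).hasFDerivAt
  have hder : ∀ x ∈ B, ∀ u v,
      fderiv ℝ α x u v + Γ x u (α x v) = G x (fderiv ℝ β x u v) := fun x hx u v => by
    have h1 : HasFDerivAt (fun y => α y v) _ x :=
      (hdiff hα x hx).clm_apply (hasFDerivAt_const v x)
    have h2 : HasFDerivAt (fun y => G y (β y v)) _ x :=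
      (hGd' x hx).clm_apply ((hdiff hβs x hx).clm_apply (hasFDerivAt_const v x))
    have h3 : (fun y => G y (β y v)) =ᶠ[𝓝 x] fun y => α y v := by
      filter_upwards [hB.mem_nhds hx] with y hy using hGβ y hy v
    have h4 := congrArg (fun T => T u) (h1.unique (h2.congr_of_eventuallyEq h3.symm))
    simp [hGd x hx] at h4
    rw [h4, hGβ x hx]
    abel
  obtain ⟨h, hh⟩ : ∃ h, ∀ x ∈ B, HasFDerivAt h (β x) x :=
    hBc.exists_forall_hasFDerivAt_of_fderiv_symmetric hB
    (hβs.differentiableOn (by simp)) (fun x hx u v => by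
      have h0 := hαc x hx u v
      rw [hder x hx, hder x hx, ← map_sub] at h0
      obtain ⟨g, hg⟩ := hGu x hx
      have h1 := congrArg (fun w => (↑g⁻¹ : F →L[ℝ] F) w) h0
      rw [← hg] at h1
      have h2 : ∀ w, (↑g⁻¹ : F →L[ℝ] F) ((g : F →L[ℝ] F) w) = w := fun w =>
        congrArg (fun T : F →L[ℝ] F => T w) g.inv_mul
      simp only [h2, map_zero] at h1
      exact sub_eq_zero.1 h1)
  have hhs : ContDiffOn ℝ ∞ h B := by
    rw [contDiffOn_infty_iff_fderiv_of_isOpen hB]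
    exact ⟨fun x hx => (hh x hx).differentiableAt.differentiableWithinAt,
      hβs.congr fun x hx => (hh x hx).fderiv⟩
  refine ⟨fun x => G x (h x), hG.clm_apply hhs, fun x hx u => ?_⟩
  rw [((hGd' x hx).clm_apply (hh x hx)).fderiv]
  simp [hGd x hx, hGβ x hx]

end Analysis

/-! ### Locality and smoothness of covariant derivatives -/

section Pointwise

variable {n : ℕ} {M : Type*} [TopologicalSpace M]
  [ChartedSpace (EuclideanSpace ℝ (Fin n)) M] [IsManifold (𝓡 n) ∞ M]

theorem SmoothAt.mdifferentiableAt {X : VField n M} {x : M} (h : SmoothAt X x) :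
    MDifferentiableAt (𝓡 n) (𝓡 n).tangent
      (fun y => (⟨y, X y⟩ : TangentBundle (𝓡 n) M)) x :=
  ContMDiffAt.mdifferentiableAt h (by simp)

theorem SmoothAt.congr {X Y : VField n M} {x : M} (h : SmoothAt X x)
    (hXY : ∀ᶠ y in 𝓝 x, Y y = X y) : SmoothAt Y x :=
  ContMDiffAt.congr_of_eventuallyEq h (hXY.mono fun y hy => by simp only [hy])

theorem conn_congr (D : AffConn n M) {X Y : VField n M} {x : M} (hX : SmoothAt X x)
    (hXY : ∀ᶠ y in 𝓝 x, Y y = X y) : D Y x = D X x :=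
  D.isCovariantDerivativeOnUniv.congr_of_eventuallyEq (hX.congr hXY).mdifferentiableAt
    hX.mdifferentiableAt Filter.univ_mem hXY

/-- Smoothness of a connection will be applied to globally smooth fields; a bump function reduces
the local case to it. -/
theorem exists_global_extension [T2Space M] {X : VField n M} {U : Set M} (hU : IsOpen U)
    (hX : SmoothOn X U) {x : M} (hx : x ∈ U) :
    ∃ X' : VField n M, (∀ y, SmoothAt X' y) ∧ ∀ᶠ y in 𝓝 x, X' y = X y := by
  obtain ⟨f, hf⟩ := (SmoothBumpFunction.nhds_basis_support (I := 𝓡 n) (hU.mem_nhds hx)).ex_mem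
  refine ⟨fun y => f y • X y, fun y => ?_, ?_⟩
  · by_cases hy : y ∈ U
    · exact ContMDiffAt.smul_section f.contMDiffAt (hX y hy)
    · have h0 : SmoothAt (0 : VField n M) y :=
        Bundle.contMDiff_zeroSection ℝ (TangentSpace (𝓡 n) : M → Type _) y
      refine h0.congr ?_
      filter_upwards [notMem_tsupport_iff_eventuallyEq.1 (fun h => hy (hf h))] with z hz
      simp only [hz, Pi.zero_apply, zero_smul]
  · filter_upwards [f.eventuallyEq_one] with y hy
    simp only [hy, Pi.one_apply, one_smul]

theorem smoothAt_cov [T2Space M] {D : AffConn n M} (hD : D.ContMDiffCovariantDerivative ∞)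
    {X Y : VField n M} {U : Set M} (hU : IsOpen U) (hX : SmoothOn X U) {x : M} (hx : x ∈ U)
    (hY : SmoothAt Y x) : SmoothAt (cov D Y X) x := by
  obtain ⟨X', hX', heq⟩ := exists_global_extension hU hX hx
  have h1 := hD.contMDiff.contMDiff (σ := X') (fun y _ => (hX' y).contMDiffWithinAt)
  have h2 := h1.contMDiffAt (x := x) Filter.univ_mem
  have h3 : SmoothAt (cov D Y X') x := ContMDiffAt.clm_bundle_apply h2 hY
  refine h3.congr ?_
  filter_upwards [heq.eventually_nhds] with y hy
  simp only [cov]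
  rw [conn_congr D (hX' y) (hy.mono fun z hz => hz.symm)]

/-! ### The difference of two equivalent connections and its consequences -/

variable {c : MulField n M} {e E : VField n M} {D₁ D₂ : AffConn n M}

theorem mul_unit (hF : IsFManifold c e) (X : VField n M) : mul c X e = X := by
  funext x
  simp only [mul]
  rw [hF.comm, hF.unit]

theorem mul_comm' (hF : IsFManifold c e) (X Y : VField n M) : mul c X Y = mul c Y X := by
  funext x
  exact hF.comm x _ _

/-- The difference of hydrodynamically equivalent connections is symmetric with respect to
multiplication. -/
theorem HydroEquivalent.sub_mul (hD : HydroEquivalent c D₁ D₂) {P Y Z : VField n M} {x : M}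
    (hP : SmoothAt P x) (hY : SmoothAt Y x) (hZ : SmoothAt Z x) :
    D₁ (mul c P Z) x (Y x) - D₂ (mul c P Z) x (Y x)
      = D₁ (mul c P Y) x (Z x) - D₂ (mul c P Y) x (Z x) := by
  have h : (D₁ (mul c P Z) x (Y x) - D₁ (mul c P Y) x (Z x) - c x (P x) (bracket Y Z x))
      - (D₂ (mul c P Z) x (Y x) - D₂ (mul c P Y) x (Z x) - c x (P x) (bracket Y Z x)) = 0 :=
    hD.equiv P Y Z x hP hY hZ
  rw [← sub_eq_zero, ← h]
  abel

/-- The difference of hydrodynamically equivalent connections is multiplication by a vector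
field. -/
theorem HydroEquivalent.difference_eq (hF : IsFManifold c e) (hD : HydroEquivalent c D₁ D₂)
    {X Y : VField n M} {x : M} (hX : SmoothAt X x) (hY : SmoothAt Y x) :
    D₁ X x (Y x) - D₂ X x (Y x)
      = c x (D₁ e x (e x) - D₂ e x (e x)) (c x (X x) (Y x)) := by
  have he := hF.smooth_unit x
  -- With `B(P, Q)` the difference of the two derivatives of `P` along `Q`, taking `e` as third
  -- field gives `B(P, Q) = T(P ∘ Q)`, where `T(P) = B(P, e)`.
  have hB : ∀ {P Q : VField n M}, SmoothAt P x → SmoothAt Q x →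
      D₁ P x (Q x) - D₂ P x (Q x) = D₁ (mul c P Q) x (e x) - D₂ (mul c P Q) x (e x) := by
    intro P Q hP hQ
    have := hD.sub_mul hP hQ he
    rwa [mul_unit hF] at this
  -- `T` is linear over `∘`: subtract the two identities `(∇_Q ∘)(e, P) = (∇_e ∘)(Q, P)` and use
  -- `B(e, Q) = T(Q)`. Hence `T(X) = X ∘ T(e)`.
  have hsym : ∀ {P Q : VField n M}, SmoothAt P x → SmoothAt Q x →
      c x (Q x) (D₁ P x (e x) - D₂ P x (e x))
        = D₁ (mul c Q P) x (e x) - D₂ (mul c Q P) x (e x) := by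
    intro P Q hP hQ
    have h1 : D₁ (mul c P e) x (Q x) - c x (D₁ P x (Q x)) (e x) - c x (P x) (D₁ e x (Q x))
        = D₁ (mul c Q P) x (e x) - c x (D₁ Q x (e x)) (P x) - c x (Q x) (D₁ P x (e x)) := by
      have := hD.left.symm_covMul Q e P x hQ he hP
      rw [show covMul D₁ c Q e P x = D₁ (mul c e P) x (Q x) - c x (D₁ e x (Q x)) (P x)
        - c x (e x) (D₁ P x (Q x)) from rfl, mul_comm' hF e P, hF.comm x _ (P x),
        hF.comm x (e x)] at this
      rw [sub_right_comm, this]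
      rfl
    have h2 : D₂ (mul c P e) x (Q x) - c x (D₂ P x (Q x)) (e x) - c x (P x) (D₂ e x (Q x))
        = D₂ (mul c Q P) x (e x) - c x (D₂ Q x (e x)) (P x) - c x (Q x) (D₂ P x (e x)) := by
      have := hD.right.symm_covMul Q e P x hQ he hP
      rw [show covMul D₂ c Q e P x = D₂ (mul c e P) x (Q x) - c x (D₂ e x (Q x)) (P x)
        - c x (e x) (D₂ P x (Q x)) from rfl, mul_comm' hF e P, hF.comm x _ (P x),
        hF.comm x (e x)] at this
      rw [sub_right_comm, this]
      rfl
    have h3 : c x (P x) (D₁ e x (Q x) - D₂ e x (Q x))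
        = c x (D₁ Q x (e x) - D₂ Q x (e x)) (P x) := by
      rw [hB he hQ, mul_comm' hF e Q, mul_unit hF, hF.comm]
    rw [mul_unit hF, hF.comm x _ (e x), hF.unit] at h1 h2
    rw [map_sub] at h3 ⊢
    rw [map_sub, sub_apply] at h3
    have h4 := congrArg₂ (· - ·) h1 h2
    rw [← sub_eq_zero] at h3 h4 ⊢
    rw [← h4, ← sub_eq_zero, ← h3]
    abel
  rw [hB hX hY, ← mul_unit hF (mul c X Y), ← hsym he (hF.smooth_mul X Y x hX hY), hF.comm]
  rfl

/-- The obstruction to `d_{∇₁} d_{∇₂} X = 0`. -/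
theorem dEnd_dVF_eq [T2Space M] (hF : IsFManifold c e) (hD : HydroEquivalent c D₁ D₂)
    (hflat₂ : IsFlat D₂) {U : Set M} (hU : IsOpen U) {X Y Z : VField n M} (hX : SmoothOn X U)
    {x : M} (hx : x ∈ U) (hY : SmoothAt Y x) (hZ : SmoothAt Z x) :
    dEnd D₁ (dVF D₂ X) Y Z x
      = c x (D₁ e x (e x) - D₂ e x (e x)) (c x (D₂ X x (Z x)) (Y x))
        - c x (D₁ e x (e x) - D₂ e x (e x)) (c x (D₂ X x (Y x)) (Z x)) := by
  -- With `D₂` as outer connection the expression is the curvature of `D₂`, which vanishes; only the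
  -- two difference terms survive.
  have h1 : D₂ (cov D₂ Z X) x (Y x) - D₂ (cov D₂ Y X) x (Z x) - D₂ X x (bracket Y Z x) = 0 :=
    hflat₂ Y Z X x hY hZ (hX x hx)
  have h2 := hD.difference_eq hF (smoothAt_cov hD.right.smooth hU hX hx hZ) hY
  have h3 := hD.difference_eq hF (smoothAt_cov hD.right.smooth hU hX hx hY) hZ
  change D₁ (cov D₂ Z X) x (Y x) - D₁ (cov D₂ Y X) x (Z x) - D₂ X x (bracket Y Z x) = _
  simp only [cov] at h1 h2 h3 ⊢
  rw [← h2, ← h3, ← sub_eq_zero, ← h1]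
  abel

/-- In the obstruction to `d_{∇₁} d_{∇₂} X = 0`, the two connections are interchangeable. -/
theorem dEnd_dVF_eq' [T2Space M] (hF : IsFManifold c e) (hD : HydroEquivalent c D₁ D₂)
    (hflat₂ : IsFlat D₂) {U : Set M} (hU : IsOpen U) {X Y Z : VField n M} (hX : SmoothOn X U)
    {x : M} (hx : x ∈ U) (hY : SmoothAt Y x) (hZ : SmoothAt Z x) :
    dEnd D₁ (dVF D₂ X) Y Z x
      = c x (D₁ e x (e x) - D₂ e x (e x)) (c x (D₁ X x (Z x)) (Y x))
        - c x (D₁ e x (e x) - D₂ e x (e x)) (c x (D₁ X x (Y x)) (Z x)) := by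
  rw [dEnd_dVF_eq hF hD hflat₂ hU hX hx hY hZ]
  have h2 := hD.difference_eq hF (hX x hx) hY
  have h3 := hD.difference_eq hF (hX x hx) hZ
  rw [sub_eq_iff_eq_add'] at h2 h3
  -- The correction terms are both `b ∘ b ∘ X ∘ Y ∘ Z` and cancel.
  rw [h2, h3, map_add, map_add, add_apply, add_apply, map_add, map_add, hF.assoc, hF.assoc,
    hF.assoc, hF.assoc, hF.comm x (Z x) (Y x)]
  abel

/-- The obstruction for `X'`, written with `D₁`, is the obstruction for `X`, written with `D₂`. -/
theorem IsSolutionOn.of_lenardMagri [T2Space M] (hF : IsFManifold c e)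
    (hD : HydroEquivalent c D₁ D₂) (hflat₂ : IsFlat D₂) {U : Set M} (hU : IsOpen U)
    {X X' : VField n M} (hX : IsSolutionOn D₁ D₂ U X) (hX' : SmoothOn X' U)
    (h : LenardMagriOn D₁ D₂ U X X') : IsSolutionOn D₁ D₂ U X' := by
  refine ⟨hX', fun x hx Y Z hY hZ => ?_⟩
  have h1 : D₁ X' x = D₂ X x := h x hx
  rw [dEnd_dVF_eq' hF hD hflat₂ hU hX' hx hY hZ, h1,
    ← dEnd_dVF_eq hF hD hflat₂ hU hX.1 hx hY hZ]
  exact hX.2 x hx Y Z hY hZ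

/-- Turns identities proved for fields smooth at `x` into identities for tangent vectors. -/
theorem exists_smoothAt_extension (x : M) (v : TangentSpace (𝓡 n) x) :
    ∃ Y : VField n M, SmoothAt Y x ∧ Y x = v := by
  set t := trivializationAt (EuclideanSpace ℝ (Fin n)) (TangentSpace (𝓡 n) : M → Type _) x
  have hx : x ∈ t.baseSet := FiberBundle.mem_baseSet_trivializationAt' x
  refine ⟨fun y => t.symmL ℝ y (t.continuousLinearMapAt ℝ x v), ?_,
    t.symmL_continuousLinearMapAt hx v⟩
  refine (t.contMDiffAt_section_iff hx).2 ?_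
  refine (contMDiffAt_const (c := t.continuousLinearMapAt ℝ x v)).congr_of_eventuallyEq ?_
  filter_upwards [t.open_baseSet.mem_nhds hx] with y hy
  simp [hy]

/-- The new endomorphism differs from the old one by multiplication by `b ∘ X`, and multiplications
commute with each other. -/
theorem CommutesOn.of_lenardMagri (hF : IsFManifold c e)
    (hD : HydroEquivalent c D₁ D₂) {U : Set M} {X X' : VField n M} (hX : SmoothOn X U)
    (h : LenardMagriOn D₁ D₂ U X X') (hc : CommutesOn D₁ (mulBy c E) U X) :
    CommutesOn D₁ (mulBy c E) U X' := by
  intro x hx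
  have h1 : dVF D₁ X' x = dVF D₂ X x := h x hx
  rw [h1]
  have hsub : ∀ v, D₂ X x v
      = D₁ X x v - c x (D₁ e x (e x) - D₂ e x (e x)) (c x (X x) v) := fun v => by
    obtain ⟨Y, hY, rfl⟩ := exists_smoothAt_extension x v
    rw [← hD.difference_eq hF (hX x hx) hY]
    abel
  generalize D₁ e x (e x) - D₂ e x (e x) = b at hsub
  ext1 v
  have h2 : D₁ X x (c x (E x) v) = c x (E x) (D₁ X x v) :=
    congrArg (fun T => T v) (hc x hx)
  change D₂ X x (c x (E x) v) = c x (E x) (D₂ X x v)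
  rw [hsub, hsub, h2, map_sub, sub_right_inj, ← hF.assoc x (X x), hF.comm x (X x),
    hF.assoc x (E x), ← hF.assoc x _ (E x), hF.comm x _ (E x), hF.assoc]

theorem isSolutionOn_of_flat [T2Space M] (hF : IsFManifold c e)
    (hD : HydroEquivalent c D₁ D₂) (hflat₂ : IsFlat D₂) {U : Set M} (hU : IsOpen U)
    {X : VField n M} (hX : SmoothOn X U) (h : ∀ x ∈ U, dVF D₁ X x = 0) :
    IsSolutionOn D₁ D₂ U X := by
  refine ⟨hX, fun x hx Y Z hY hZ => ?_⟩
  have h1 : D₁ X x = 0 := h x hx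
  rw [dEnd_dVF_eq' hF hD hflat₂ hU hX hx hY hZ, h1]
  simp

theorem commutesOn_of_flat {U : Set M} {X : VField n M} (h : ∀ x ∈ U, dVF D₁ X x = 0)
    (L : EndField n M) : CommutesOn D₁ L U X := fun x hx => by
  rw [h x hx, ContinuousLinearMap.zero_comp, ContinuousLinearMap.comp_zero]

theorem IsSolutionOn.mono {U V : Set M} {X : VField n M} (h : IsSolutionOn D₁ D₂ U X)
    (hVU : V ⊆ U) : IsSolutionOn D₁ D₂ V X :=
  ⟨fun x hx => h.1 x (hVU hx), fun x hx => h.2 x (hVU hx)⟩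

end Pointwise

/-! ### Connections in a chart and local solvability -/

section Coordinates

variable {n : ℕ} {M : Type*} [TopologicalSpace M]
  [ChartedSpace (EuclideanSpace ℝ (Fin n)) M] {p x : M}

theorem extChartAt_symm_extChartAt (hx : x ∈ (chartAt (EuclideanSpace ℝ (Fin n)) p).source) :
    (extChartAt (𝓡 n) p).symm (extChartAt (𝓡 n) p x) = x :=
  (extChartAt (𝓡 n) p).left_inv (by rwa [extChartAt_source])

theorem extChartAt_mem_target (hx : x ∈ (chartAt (EuclideanSpace ℝ (Fin n)) p).source) :
    extChartAt (𝓡 n) p x ∈ (extChartAt (𝓡 n) p).target :=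
  (extChartAt (𝓡 n) p).map_source (by simpa using hx)

theorem extChartAt_symm_mem_source {y : EuclideanSpace ℝ (Fin n)}
    (hy : y ∈ (extChartAt (𝓡 n) p).target) :
    (extChartAt (𝓡 n) p).symm y ∈ (chartAt (EuclideanSpace ℝ (Fin n)) p).source := by
  simpa using (extChartAt (𝓡 n) p).map_target hy

variable [IsManifold (𝓡 n) ∞ M]

/-- The components of a tangent vector at `x` in the chart at `p`. -/
def toCoord (p x : M) : TangentSpace (𝓡 n) x →L[ℝ] EuclideanSpace ℝ (Fin n) :=
  (trivializationAt (EuclideanSpace ℝ (Fin n))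
    (TangentSpace (𝓡 n) : M → Type _) p).continuousLinearMapAt ℝ x

/-- The tangent vector at `x` with given components in the chart at `p`. -/
def ofCoord (p x : M) : EuclideanSpace ℝ (Fin n) →L[ℝ] TangentSpace (𝓡 n) x :=
  (trivializationAt (EuclideanSpace ℝ (Fin n)) (TangentSpace (𝓡 n) : M → Type _) p).symmL ℝ x

/-- The vector field with constant components in the chart at `p`. -/
def coordField (p : M) (w : EuclideanSpace ℝ (Fin n)) : VField n M :=
  fun x => ofCoord p x w

/-- The components of a vector field in the chart at `p`. -/
def coordRep (p : M) (X : VField n M) (y : EuclideanSpace ℝ (Fin n)) : EuclideanSpace ℝ (Fin n) :=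
  toCoord p ((extChartAt (𝓡 n) p).symm y) (X ((extChartAt (𝓡 n) p).symm y))

theorem toCoord_ofCoord (hx : x ∈ (chartAt (EuclideanSpace ℝ (Fin n)) p).source)
    (w : EuclideanSpace ℝ (Fin n)) : toCoord p x (ofCoord p x w) = w :=
  Bundle.Trivialization.continuousLinearMapAt_symmL _ hx w

theorem ofCoord_toCoord (hx : x ∈ (chartAt (EuclideanSpace ℝ (Fin n)) p).source)
    (v : TangentSpace (𝓡 n) x) : ofCoord p x (toCoord p x v) = v :=
  Bundle.Trivialization.symmL_continuousLinearMapAt _ hx v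

theorem toCoord_injective (hx : x ∈ (chartAt (EuclideanSpace ℝ (Fin n)) p).source) :
    Function.Injective (toCoord (n := n) p x) :=
  Function.LeftInverse.injective (ofCoord_toCoord hx)

theorem coordRep_apply (hx : x ∈ (chartAt (EuclideanSpace ℝ (Fin n)) p).source)
    (X : VField n M) : coordRep p X (extChartAt (𝓡 n) p x) = toCoord p x (X x) := by
  rw [coordRep, extChartAt_symm_extChartAt hx]

theorem smoothAt_iff_contMDiffAt (hx : x ∈ (chartAt (EuclideanSpace ℝ (Fin n)) p).source)
    {X : VField n M} : SmoothAt X x ↔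
      ContMDiffAt (𝓡 n) 𝓘(ℝ, EuclideanSpace ℝ (Fin n)) ∞ (fun y => toCoord p y (X y)) x := by
  let t := trivializationAt (EuclideanSpace ℝ (Fin n)) (TangentSpace (𝓡 n) : M → Type _) p
  have hx' : x ∈ t.baseSet := hx
  refine (t.contMDiffAt_section_iff hx').trans (Filter.EventuallyEq.contMDiffAt_iff ?_)
  filter_upwards [t.open_baseSet.mem_nhds hx'] with y hy
  rw [toCoord, Bundle.Trivialization.continuousLinearMapAt_apply,
    Bundle.Trivialization.linearMapAt_apply, if_pos hy]

theorem smoothAt_iff_contDiffAt (hx : x ∈ (chartAt (EuclideanSpace ℝ (Fin n)) p).source)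
    {X : VField n M} : SmoothAt X x ↔ ContDiffAt ℝ ∞ (coordRep p X) (extChartAt (𝓡 n) p x) := by
  rw [smoothAt_iff_contMDiffAt hx, ← contMDiffAt_iff_contDiffAt]
  have hy := extChartAt_mem_target hx
  have hinv : (extChartAt (𝓡 n) p).symm (extChartAt (𝓡 n) p x) = x :=
    extChartAt_symm_extChartAt hx
  constructor
  · intro h
    have h1 : ContMDiffAt 𝓘(ℝ, EuclideanSpace ℝ (Fin n)) (𝓡 n) ∞ (extChartAt (𝓡 n) p).symm
        (extChartAt (𝓡 n) p x) :=
      (contMDiffOn_extChartAt_symm p).contMDiffAt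
        ((isOpen_extChartAt_target p).mem_nhds hy)
    exact ContMDiffAt.comp_of_eq h h1 hinv
  · intro h
    have h1 : ContMDiffAt (𝓡 n) 𝓘(ℝ, EuclideanSpace ℝ (Fin n)) ∞ (extChartAt (𝓡 n) p) x :=
      contMDiffAt_extChartAt' hx
    refine (h.comp x h1).congr_of_eventuallyEq ?_
    filter_upwards [(chartAt (EuclideanSpace ℝ (Fin n)) p).open_source.mem_nhds hx] with z hz
    exact (coordRep_apply hz X).symm

theorem coordRep_coordField {y : EuclideanSpace ℝ (Fin n)} (hy : y ∈ (extChartAt (𝓡 n) p).target)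
    (w : EuclideanSpace ℝ (Fin n)) : coordRep p (coordField p w) y = w :=
  toCoord_ofCoord (extChartAt_symm_mem_source hy) w

theorem coordRep_coordField_eventuallyEq {y : EuclideanSpace ℝ (Fin n)}
    (hy : y ∈ (extChartAt (𝓡 n) p).target) (w : EuclideanSpace ℝ (Fin n)) :
    coordRep p (coordField p w) =ᶠ[𝓝 y] fun _ => w := by
  filter_upwards [(isOpen_extChartAt_target p).mem_nhds hy] with z hz
  exact coordRep_coordField hz w

theorem smoothAt_coordField (hx : x ∈ (chartAt (EuclideanSpace ℝ (Fin n)) p).source)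
    (w : EuclideanSpace ℝ (Fin n)) : SmoothAt (coordField p w) x := by
  rw [smoothAt_iff_contDiffAt hx]
  exact contDiffAt_const.congr_of_eventuallyEq
    (coordRep_coordField_eventuallyEq (extChartAt_mem_target hx) w)

/-- A constant vector field on Euclidean space. -/
def constField (u y : EuclideanSpace ℝ (Fin n)) : TangentSpace (𝓡 n) y := u

/-- These fields are pull-backs of constant fields under the chart, and pull-back respects brackets.
-/
theorem bracket_coordField (hx : x ∈ (chartAt (EuclideanSpace ℝ (Fin n)) p).source)
    (v w : EuclideanSpace ℝ (Fin n)) : bracket (coordField p v) (coordField p w) x = 0 := by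
  have hpull : ∀ u : EuclideanSpace ℝ (Fin n), coordField p u =ᶠ[𝓝 x]
      VectorField.mpullback (𝓡 n) (𝓡 n) (extChartAt (𝓡 n) p) (constField u) := fun u => by
    filter_upwards [(chartAt (EuclideanSpace ℝ (Fin n)) p).open_source.mem_nhds hx] with z hz
    rw [VectorField.mpullback_apply, ← TangentBundle.continuousLinearMapAt_trivializationAt hz]
    have : (toCoord (n := n) p z).inverse = ofCoord p z := by
      refine ContinuousLinearMap.inverse_eq ?_ ?_
      · ext1 a
        exact toCoord_ofCoord hz a
      · ext1 a
        exact ofCoord_toCoord hz a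
    exact congrArg (fun T => T u) this.symm
  have : IsManifold (𝓡 n) (minSmoothness ℝ 2) M := by
    rw [minSmoothness_of_isRCLikeNormedField]
    infer_instance
  rw [bracket, (hpull v).mlieBracket_vectorField_eq (hpull w),
    ← VectorField.mpullback_mlieBracket (n := ∞)]
  · rw [VectorField.mpullback_apply]
    have : VectorField.mlieBracket (𝓡 n) (constField v) (constField w)
        (extChartAt (𝓡 n) p x) = 0 := by
      rw [← VectorField.mlieBracketWithin_univ,
        VectorField.mlieBracketWithin_eq_lieBracketWithin]
      have hc : ∀ u : EuclideanSpace ℝ (Fin n), constField u = fun _ => u := fun u => rfl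
      simp only [VectorField.lieBracketWithin, hc, fderivWithin_fun_const]
      simp
      rfl
    rw [this, map_zero]
  · exact (contMDiffAt_vectorSpace_iff_contDiffAt.2
      (contDiffAt_const (n := 1))).mdifferentiableAt one_ne_zero
  · exact (contMDiffAt_vectorSpace_iff_contDiffAt.2
      (contDiffAt_const (n := 1))).mdifferentiableAt one_ne_zero
  · exact contMDiffAt_extChartAt' hx
  · rw [minSmoothness_of_isRCLikeNormedField]
    exact WithTop.coe_le_coe.2 (le_top : (2 : ℕ∞) ≤ ⊤)

/-- The matrix of the endomorphism `v ↦ ∇_v X` in the chart at `p`. -/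
def coordDeriv (D : AffConn n M) (p : M) (X : VField n M) (y : EuclideanSpace ℝ (Fin n)) :
    EuclideanSpace ℝ (Fin n) →L[ℝ] EuclideanSpace ℝ (Fin n) :=
  (toCoord p ((extChartAt (𝓡 n) p).symm y)).comp
    ((D X ((extChartAt (𝓡 n) p).symm y)).comp (ofCoord p ((extChartAt (𝓡 n) p).symm y)))

/-- The connection form of an affine connection in the chart at `p`. -/
def connForm (D : AffConn n M) (p : M) (y : EuclideanSpace ℝ (Fin n)) :
    EuclideanSpace ℝ (Fin n) →L[ℝ] EuclideanSpace ℝ (Fin n) →L[ℝ] EuclideanSpace ℝ (Fin n) :=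
  (∑ i, (EuclideanSpace.proj i : EuclideanSpace ℝ (Fin n) →L[ℝ] ℝ).smulRight
    (coordDeriv D p (coordField p (EuclideanSpace.single i 1)) y)).flip

theorem connForm_apply (D : AffConn n M) (p : M) (y v w : EuclideanSpace ℝ (Fin n)) :
    connForm D p y v w
      = ∑ i, w i • coordDeriv D p (coordField p (EuclideanSpace.single i 1)) y v := by
  simp [connForm]

/-- Smoothness is proved alongside because additivity of `D` in the induction requires it of the
partial sums. -/
theorem conn_sum (D : AffConn n M) {ι : Type*} (s : Finset ι) {f : ι → M → ℝ}
    {X : ι → VField n M} (hf : ∀ i, ContMDiffAt (𝓡 n) 𝓘(ℝ, ℝ) ∞ (f i) x)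
    (hX : ∀ i, SmoothAt (X i) x) :
    SmoothAt (fun y => ∑ i ∈ s, f i y • X i y) x ∧
    D (fun y => ∑ i ∈ s, f i y • X i y) x
      = ∑ i ∈ s, (f i x • D (X i) x + (mvfderiv (𝓡 n) (f i) x).smulRight (X i x)) := by
  classical
  induction s using Finset.induction_on with
  | empty =>
    simp only [Finset.sum_empty]
    refine ⟨Bundle.contMDiff_zeroSection ℝ (TangentSpace (𝓡 n) : M → Type _) x, ?_⟩
    exact congrFun D.zero x
  | insert a s ha ih =>
    have h1 : SmoothAt (fun y => f a y • X a y) x := (hf a).smul_section (hX a)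
    have h2 : D (fun y => f a y • X a y) x
        = f a x • D (X a) x + (mvfderiv (𝓡 n) (f a) x).smulRight (X a x) :=
      D.isCovariantDerivativeOnUniv.leibniz (hX a).mdifferentiableAt
        ((hf a).mdifferentiableAt (by simp))
    simp only [Finset.sum_insert ha]
    refine ⟨ContMDiffAt.add_section h1 ih.1, ?_⟩
    rw [← ih.2, ← h2]
    exact D.isCovariantDerivativeOnUniv.add h1.mdifferentiableAt ih.1.mdifferentiableAt

theorem mvfderiv_coord (hx : x ∈ (chartAt (EuclideanSpace ℝ (Fin n)) p).source)
    {X : VField n M} (hX : SmoothAt X x) (i : Fin n) (v : EuclideanSpace ℝ (Fin n)) :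
    mvfderiv (𝓡 n) (fun y => toCoord p y (X y) i) x (ofCoord p x v)
      = fderiv ℝ (coordRep p X) (extChartAt (𝓡 n) p x) v i := by
  have h1 : (fun y => toCoord p y (X y) i) =ᶠ[𝓝 x]
      ((fun z => coordRep p X z i) ∘ extChartAt (𝓡 n) p) := by
    filter_upwards [(chartAt (EuclideanSpace ℝ (Fin n)) p).open_source.mem_nhds hx] with z hz
    rw [Function.comp_apply, coordRep_apply hz]
  have hd : DifferentiableAt ℝ (coordRep p X) (extChartAt (𝓡 n) p x) :=
    ((smoothAt_iff_contDiffAt hx).1 hX).differentiableAt (by simp)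
  have h2 : HasFDerivAt (fun z => coordRep p X z i)
      ((EuclideanSpace.proj i : EuclideanSpace ℝ (Fin n) →L[ℝ] ℝ).comp
        (fderiv ℝ (coordRep p X) (extChartAt (𝓡 n) p x))) (extChartAt (𝓡 n) p x) :=
    (EuclideanSpace.proj i : EuclideanSpace ℝ (Fin n) →L[ℝ] ℝ).hasFDerivAt.comp _ hd.hasFDerivAt
  have h3 := h2.hasMFDerivAt.comp x
    (mdifferentiableAt_extChartAt (I := 𝓡 n) hx).hasMFDerivAt
  have h4 := (h3.congr_of_eventuallyEq h1).mfderiv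
  have h5 : mfderiv (𝓡 n) 𝓘(ℝ, EuclideanSpace ℝ (Fin n)) (extChartAt (𝓡 n) p) x
      = toCoord p x := (TangentBundle.continuousLinearMapAt_trivializationAt hx).symm
  rw [h5] at h4
  have h6 : mvfderiv (𝓡 n) (fun y => toCoord p y (X y) i) x
      = mfderiv (𝓡 n) 𝓘(ℝ, ℝ) (fun y => toCoord p y (X y) i) x := rfl
  rw [h6, h4]
  change fderiv ℝ (coordRep p X) (extChartAt (𝓡 n) p x) (toCoord p x (ofCoord p x v)) i = _
  rw [toCoord_ofCoord hx]

theorem sum_smul_single (w : EuclideanSpace ℝ (Fin n)) :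
    ∑ i, w i • (EuclideanSpace.single i (1 : ℝ)) = w := by
  ext j
  simp [Finset.sum_apply, Pi.single_apply]

theorem linearIndependent_ofCoord (hx : x ∈ (chartAt (EuclideanSpace ℝ (Fin n)) p).source)
    {G : EuclideanSpace ℝ (Fin n) →L[ℝ] EuclideanSpace ℝ (Fin n)} (hG : IsUnit G) :
    LinearIndependent ℝ (fun i : Fin n => ofCoord p x (G (EuclideanSpace.single i (1 : ℝ)))) := by
  obtain ⟨g, rfl⟩ := hG
  rw [Fintype.linearIndependent_iff]
  intro a ha i
  have h1 := congrArg (toCoord p x) ha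
  simp only [map_sum, map_smul, toCoord_ofCoord hx, map_zero] at h1
  have h2 : ∑ i, a i • EuclideanSpace.single i (1 : ℝ) = 0 := by
    have h3 := congrArg (↑g⁻¹ : EuclideanSpace ℝ (Fin n) →L[ℝ] EuclideanSpace ℝ (Fin n)) h1
    have h4 : ∀ w, (↑g⁻¹ : EuclideanSpace ℝ (Fin n) →L[ℝ] EuclideanSpace ℝ (Fin n))
        ((g : EuclideanSpace ℝ (Fin n) →L[ℝ] EuclideanSpace ℝ (Fin n)) w) = w := fun w =>
      congrArg (fun T : EuclideanSpace ℝ (Fin n) →L[ℝ] EuclideanSpace ℝ (Fin n) => T w) g.inv_mul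
    simpa only [map_sum, map_smul, h4, map_zero] using h3
  have h5 := sum_smul_single (WithLp.toLp 2 a)
  rw [h2] at h5
  simpa using (congrArg (fun w : EuclideanSpace ℝ (Fin n) => w i) h5).symm

/-- Expand `X` near `x` in the coordinate fields and apply the Leibniz rule: derivatives of the
coefficients give the first term, derivatives of the fields the connection form. -/
theorem toCoord_conn_ofCoord (D : AffConn n M)
    (hx : x ∈ (chartAt (EuclideanSpace ℝ (Fin n)) p).source) {X : VField n M} (hX : SmoothAt X x)
    (v : EuclideanSpace ℝ (Fin n)) :
    toCoord p x (D X x (ofCoord p x v))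
      = fderiv ℝ (coordRep p X) (extChartAt (𝓡 n) p x) v
        + connForm D p (extChartAt (𝓡 n) p x) v (coordRep p X (extChartAt (𝓡 n) p x)) := by
  have hinv : (extChartAt (𝓡 n) p).symm (extChartAt (𝓡 n) p x) = x :=
    extChartAt_symm_extChartAt hx
  have hf : ∀ i : Fin n, ContMDiffAt (𝓡 n) 𝓘(ℝ, ℝ) ∞ (fun y => toCoord p y (X y) i) x := fun i =>
    (EuclideanSpace.proj i : EuclideanSpace ℝ (Fin n) →L[ℝ] ℝ).contMDiff.contMDiffAt.comp x
      ((smoothAt_iff_contMDiffAt hx).1 hX)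
  have h1 := (conn_sum D Finset.univ hf
    (fun i => smoothAt_coordField hx (EuclideanSpace.single i (1 : ℝ)))).2
  have h2 : D (fun y => ∑ i, toCoord p y (X y) i •
      coordField p (EuclideanSpace.single i (1 : ℝ)) y) x = D X x := by
    refine conn_congr D hX ?_
    filter_upwards [(chartAt (EuclideanSpace ℝ (Fin n)) p).open_source.mem_nhds hx] with z hz
    simp only [coordField, ← map_smul, ← map_sum]
    rw [sum_smul_single, ofCoord_toCoord hz]
  rw [← h2, h1, sum_apply, map_sum]
  simp only [add_apply, smul_apply, ContinuousLinearMap.smulRight_apply, map_add, map_smul,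
    mvfderiv_coord hx hX]
  rw [Finset.sum_add_distrib, add_comm, connForm_apply]
  congr 1
  · conv_rhs => rw [← sum_smul_single (fderiv ℝ (coordRep p X) (extChartAt (𝓡 n) p x) v)]
    refine Finset.sum_congr rfl fun i _ => ?_
    rw [coordField, toCoord_ofCoord hx]
  · refine Finset.sum_congr rfl fun i _ => ?_
    rw [coordRep_apply hx, coordDeriv, hinv]
    rfl

theorem coordDeriv_eq (D : AffConn n M) {y : EuclideanSpace ℝ (Fin n)}
    (hy : y ∈ (extChartAt (𝓡 n) p).target) {X : VField n M}
    (hX : SmoothAt X ((extChartAt (𝓡 n) p).symm y)) (v : EuclideanSpace ℝ (Fin n)) :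
    coordDeriv D p X y v = fderiv ℝ (coordRep p X) y v + connForm D p y v (coordRep p X y) := by
  have := toCoord_conn_ofCoord D (extChartAt_symm_mem_source hy) hX v
  rwa [(extChartAt (𝓡 n) p).right_inv hy] at this

theorem coordDeriv_coordField (D : AffConn n M) {y : EuclideanSpace ℝ (Fin n)}
    (hy : y ∈ (extChartAt (𝓡 n) p).target) (v w : EuclideanSpace ℝ (Fin n)) :
    coordDeriv D p (coordField p w) y v = connForm D p y v w := by
  rw [coordDeriv_eq D hy (smoothAt_coordField (extChartAt_symm_mem_source hy) w),
    (coordRep_coordField_eventuallyEq hy w).fderiv_eq, coordRep_coordField hy]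
  simp

theorem contDiffOn_coordRep {X : VField n M} {B : Set (EuclideanSpace ℝ (Fin n))}
    (hB : B ⊆ (extChartAt (𝓡 n) p).target)
    (hX : ∀ y ∈ B, SmoothAt X ((extChartAt (𝓡 n) p).symm y)) :
    ContDiffOn ℝ ∞ (coordRep p X) B := fun y hy => by
  have h := (smoothAt_iff_contDiffAt (extChartAt_symm_mem_source (hB hy))).1 (hX y hy)
  rw [(extChartAt (𝓡 n) p).right_inv (hB hy)] at h
  exact h.contDiffWithinAt

theorem contDiffOn_coordDeriv [T2Space M] {D : AffConn n M}
    (hD : D.ContMDiffCovariantDerivative ∞) {X : VField n M} {U : Set M} (hU : IsOpen U)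
    (hX : SmoothOn X U) {B : Set (EuclideanSpace ℝ (Fin n))}
    (hB : B ⊆ (extChartAt (𝓡 n) p).target) (hBU : ∀ y ∈ B, (extChartAt (𝓡 n) p).symm y ∈ U) :
    ContDiffOn ℝ ∞ (coordDeriv D p X) B := by
  rw [contDiffOn_clm_apply]
  intro v
  exact contDiffOn_coordRep hB fun y hy => smoothAt_cov hD hU hX (hBU y hy)
    (smoothAt_coordField (extChartAt_symm_mem_source (hB hy)) v)

theorem contDiffOn_connForm [T2Space M] {D : AffConn n M}
    (hD : D.ContMDiffCovariantDerivative ∞) (p : M) :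
    ContDiffOn ℝ ∞ (connForm D p) (extChartAt (𝓡 n) p).target := by
  rw [contDiffOn_clm_apply]
  intro v
  rw [contDiffOn_clm_apply]
  intro w
  have h := contDiffOn_coordDeriv hD (X := coordField p w)
    (chartAt (EuclideanSpace ℝ (Fin n)) p).open_source
    (fun x hx => smoothAt_coordField hx w) subset_rfl
    (fun y hy => extChartAt_symm_mem_source hy)
  exact (h.clm_apply contDiffOn_const).congr fun y hy => (coordDeriv_coordField D hy v w).symm

/-- Evaluate the curvature on coordinate fields, whose brackets vanish. -/
theorem curvatureZeroOn_connForm [T2Space M] {D : AffConn n M}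
    (hD : D.ContMDiffCovariantDerivative ∞) (hflat : IsFlat D) (p : M) :
    CurvatureZeroOn (connForm D p) (extChartAt (𝓡 n) p).target := by
  intro y hy u v w
  set x := (extChartAt (𝓡 n) p).symm y with hx
  have hxs := extChartAt_symm_mem_source hy
  have hΓ : DifferentiableAt ℝ (connForm D p) y :=
    ((contDiffOn_connForm hD p).differentiableOn (by simp)).differentiableAt
      ((isOpen_extChartAt_target p).mem_nhds hy)
  have hterm : ∀ u v : EuclideanSpace ℝ (Fin n),
      toCoord p x (D (cov D (coordField p v) (coordField p w)) x (ofCoord p x u))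
        = fderiv ℝ (connForm D p) y u v w + connForm D p y u (connForm D p y v w) := by
    intro u v
    have hs : SmoothAt (cov D (coordField p v) (coordField p w)) x :=
      smoothAt_cov hD (chartAt (EuclideanSpace ℝ (Fin n)) p).open_source
        (fun x hx => smoothAt_coordField hx w) hxs (smoothAt_coordField hxs v)
    have h1 := coordDeriv_eq D hy hs u
    have h2 : coordRep p (cov D (coordField p v) (coordField p w)) =ᶠ[𝓝 y]
        fun z => connForm D p z v w := by
      filter_upwards [(isOpen_extChartAt_target p).mem_nhds hy] with z hz
      exact coordDeriv_coordField D hz v w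
    have h3 : HasFDerivAt (fun z => connForm D p z v w) _ y :=
      (hΓ.hasFDerivAt.clm_apply (hasFDerivAt_const v y)).clm_apply (hasFDerivAt_const w y)
    rw [h2.fderiv_eq, h2.self_of_nhds, h3.fderiv] at h1
    refine Eq.trans h1 ?_
    simp
  have h0 := hflat (coordField p u) (coordField p v) (coordField p w) x
    (smoothAt_coordField hxs u) (smoothAt_coordField hxs v) (smoothAt_coordField hxs w)
  have h1 : D (cov D (coordField p v) (coordField p w)) x (ofCoord p x u)
      - D (cov D (coordField p u) (coordField p w)) x (ofCoord p x v)
      - D (coordField p w) x (bracket (coordField p u) (coordField p v) x) = 0 := h0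
  rw [bracket_coordField hxs, map_zero, sub_zero] at h1
  have h2 := congrArg (toCoord p x) h1
  rw [map_sub, map_zero, hterm, hterm] at h2
  rw [← h2]
  abel

/-- The equation evaluated on coordinate fields, in the form needed by `exists_covariant_primitive`.
-/
theorem coordDeriv_closed [T2Space M] {D₁ D₂ : AffConn n M}
    (hD₂ : D₂.ContMDiffCovariantDerivative ∞) {V : Set M} (hV : IsOpen V) {X : VField n M}
    (hX : IsSolutionOn D₁ D₂ V X) {y : EuclideanSpace ℝ (Fin n)}
    (hy : y ∈ (extChartAt (𝓡 n) p).target) (hyV : (extChartAt (𝓡 n) p).symm y ∈ V)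
    (hα : DifferentiableAt ℝ (coordDeriv D₂ p X) y) (u v : EuclideanSpace ℝ (Fin n)) :
    fderiv ℝ (coordDeriv D₂ p X) y u v + connForm D₁ p y u (coordDeriv D₂ p X y v)
      - (fderiv ℝ (coordDeriv D₂ p X) y v u + connForm D₁ p y v (coordDeriv D₂ p X y u)) = 0 := by
  set x := (extChartAt (𝓡 n) p).symm y with hx
  have hxs := extChartAt_symm_mem_source hy
  have hterm : ∀ u v : EuclideanSpace ℝ (Fin n),
      toCoord p x (D₁ (cov D₂ (coordField p v) X) x (ofCoord p x u))
        = fderiv ℝ (coordDeriv D₂ p X) y u v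
          + connForm D₁ p y u (coordDeriv D₂ p X y v) := by
    intro u v
    have h1 := coordDeriv_eq D₁ hy
      (smoothAt_cov hD₂ hV hX.1 hyV (smoothAt_coordField hxs v)) u
    have h3 : HasFDerivAt (fun z => coordDeriv D₂ p X z v) _ y :=
      hα.hasFDerivAt.clm_apply (hasFDerivAt_const v y)
    have h2 : coordRep p (cov D₂ (coordField p v) X) = fun z => coordDeriv D₂ p X z v := rfl
    rw [h2, h3.fderiv] at h1
    refine Eq.trans h1 ?_
    simp
  have h1 : D₁ (cov D₂ (coordField p v) X) x (ofCoord p x u)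
      - D₁ (cov D₂ (coordField p u) X) x (ofCoord p x v)
      - D₂ X x (bracket (coordField p u) (coordField p v) x) = 0 :=
    hX.2 x hyV _ _ (smoothAt_coordField hxs u) (smoothAt_coordField hxs v)
  rw [bracket_coordField hxs, map_zero, sub_zero] at h1
  have h2 := congrArg (toCoord p x) h1
  rwa [map_sub, map_zero, hterm, hterm] at h2

/-- The vector field with given components in the chart at `p`. -/
def ofCoordRep (p : M) (f : EuclideanSpace ℝ (Fin n) → EuclideanSpace ℝ (Fin n)) : VField n M :=
  fun x => ofCoord p x (f (extChartAt (𝓡 n) p x))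

theorem coordRep_ofCoordRep {f : EuclideanSpace ℝ (Fin n) → EuclideanSpace ℝ (Fin n)}
    {y : EuclideanSpace ℝ (Fin n)} (hy : y ∈ (extChartAt (𝓡 n) p).target) :
    coordRep p (ofCoordRep p f) y = f y := by
  rw [coordRep, ofCoordRep, toCoord_ofCoord (extChartAt_symm_mem_source hy),
    (extChartAt (𝓡 n) p).right_inv hy]

theorem coordRep_ofCoordRep_eventuallyEq
    {f : EuclideanSpace ℝ (Fin n) → EuclideanSpace ℝ (Fin n)} {y : EuclideanSpace ℝ (Fin n)}
    (hy : y ∈ (extChartAt (𝓡 n) p).target) : coordRep p (ofCoordRep p f) =ᶠ[𝓝 y] f := by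
  filter_upwards [(isOpen_extChartAt_target p).mem_nhds hy] with z hz
  exact coordRep_ofCoordRep hz

theorem smoothAt_ofCoordRep {f : EuclideanSpace ℝ (Fin n) → EuclideanSpace ℝ (Fin n)}
    (hx : x ∈ (chartAt (EuclideanSpace ℝ (Fin n)) p).source)
    (hf : ContDiffAt ℝ ∞ f (extChartAt (𝓡 n) p x)) : SmoothAt (ofCoordRep p f) x := by
  rw [smoothAt_iff_contDiffAt hx]
  exact hf.congr_of_eventuallyEq (coordRep_ofCoordRep_eventuallyEq (extChartAt_mem_target hx))

theorem toCoord_conn_ofCoordRep (D : AffConn n M)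
    {f : EuclideanSpace ℝ (Fin n) → EuclideanSpace ℝ (Fin n)}
    (hx : x ∈ (chartAt (EuclideanSpace ℝ (Fin n)) p).source)
    (hf : ContDiffAt ℝ ∞ f (extChartAt (𝓡 n) p x)) (v : EuclideanSpace ℝ (Fin n)) :
    toCoord p x (D (ofCoordRep p f) x (ofCoord p x v))
      = fderiv ℝ f (extChartAt (𝓡 n) p x) v
        + connForm D p (extChartAt (𝓡 n) p x) v (f (extChartAt (𝓡 n) p x)) := by
  have h := coordRep_ofCoordRep_eventuallyEq (f := f) (extChartAt_mem_target hx)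
  rw [toCoord_conn_ofCoord D hx (smoothAt_ofCoordRep hx hf), h.fderiv_eq, h.self_of_nhds]

/-- Around every point, a flat connection has a flat frame, and the Lenard-Magri recursion can be
solved for all solutions at once. -/
theorem exists_nhds_flatFrame_and_lenardMagri [T2Space M] {D₁ : AffConn n M}
    (hD₁ : D₁.ContMDiffCovariantDerivative ∞) (hflat : IsFlat D₁) {U : Set M} (hU : IsOpen U)
    (hp : p ∈ U) :
    ∃ V : Set M, IsOpen V ∧ p ∈ V ∧ V ⊆ U ∧ (∃ X : Fin n → VField n M, IsFlatFrameOn D₁ V X) ∧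
      ∀ D₂ : AffConn n M, D₂.ContMDiffCovariantDerivative ∞ → ∀ X : VField n M,
        IsSolutionOn D₁ D₂ V X → ∃ X' : VField n M, SmoothOn X' V ∧ LenardMagriOn D₁ D₂ V X X' := by
  set ψ := extChartAt (𝓡 n) p with hψ
  have hW : IsOpen (ψ.target ∩ ψ.symm ⁻¹' U) :=
    (continuousOn_extChartAt_symm p).isOpen_inter_preimage (isOpen_extChartAt_target p) hU
  have hpW : ψ p ∈ ψ.target ∩ ψ.symm ⁻¹' U :=
    ⟨mem_extChartAt_target p, by simpa [hψ] using hp⟩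
  obtain ⟨r, hr, hrW, G, hG, hGu, hGd⟩ := exists_parallel_frame hW
    ((contDiffOn_connForm hD₁ p).mono Set.inter_subset_left)
    (fun y hy => curvatureZeroOn_connForm hD₁ hflat p y hy.1) hpW
  set B := Metric.ball (ψ p) r
  have hB : IsOpen B := Metric.isOpen_ball
  set V := ψ.source ∩ ψ ⁻¹' B
  have hVs : ∀ x ∈ V, x ∈ (chartAt (EuclideanSpace ℝ (Fin n)) p).source := fun x hx => by
    simpa [hψ] using hx.1
  have hV : IsOpen V :=
    (continuousOn_extChartAt p).isOpen_inter_preimage (isOpen_extChartAt_source p) hB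
  have hBV : ∀ y ∈ B, ψ.symm y ∈ V := fun y hy =>
    ⟨ψ.map_target (hrW hy).1, by
      change ψ (ψ.symm y) ∈ B
      rwa [ψ.right_inv (hrW hy).1]⟩
  refine ⟨V, hV, ⟨by simp [hψ], Metric.mem_ball_self hr⟩, fun x hx => ?_, ?_, ?_⟩
  · have := (hrW hx.2).2
    rwa [Set.mem_preimage, ψ.left_inv hx.1] at this
  · have hGs : ∀ i : Fin n, ∀ x ∈ V,
        ContDiffAt ℝ ∞ (fun y => G y (EuclideanSpace.single i (1 : ℝ))) (ψ x) := fun i x hx =>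
      (hG.contDiffAt (hB.mem_nhds hx.2)).clm_apply contDiffAt_const
    refine ⟨fun i => ofCoordRep p fun y => G y (EuclideanSpace.single i (1 : ℝ)),
      fun i x hx => smoothAt_ofCoordRep (hVs x hx) (hGs i x hx), fun i x hx => ?_, fun x hx => ?_⟩
    · ext1 v
      refine toCoord_injective (hVs x hx) ?_
      have hd : DifferentiableAt ℝ G (ψ x) :=
        (hG.differentiableOn (by simp)).differentiableAt (hB.mem_nhds hx.2)
      have h1 := toCoord_conn_ofCoordRep D₁ (hVs x hx) (hGs i x hx) (toCoord p x v)
      rw [ofCoord_toCoord (hVs x hx)] at h1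
      rw [← hψ] at h1
      refine h1.trans ?_
      have h2 : HasFDerivAt (fun y => G y (EuclideanSpace.single i (1 : ℝ))) _ (ψ x) :=
        hd.hasFDerivAt.clm_apply (hasFDerivAt_const _ _)
      rw [h2.fderiv]
      simp [hGd _ hx.2]
    · exact linearIndependent_ofCoord (hVs x hx) (hGu (ψ x) hx.2)
  -- `V` and `G` were fixed by `D₁` alone, so no shrinking occurs from one field to the next.
  · intro D₂ hD₂ X hX
    have hBt : B ⊆ ψ.target := fun y hy => (hrW hy).1
    have hα : ContDiffOn ℝ ∞ (coordDeriv D₂ p X) B :=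
      contDiffOn_coordDeriv hD₂ hV hX.1 hBt hBV
    obtain ⟨f, hf, hfα⟩ := exists_covariant_primitive hB (convex_ball _ _) hG hGu hGd hα
      (fun y hy u v => coordDeriv_closed hD₂ hV hX (hBt hy) (hBV y hy)
        ((hα.differentiableOn (by simp)).differentiableAt (hB.mem_nhds hy)) u v)
    have hfs : ∀ x ∈ V, ContDiffAt ℝ ∞ f (ψ x) := fun x hx => hf.contDiffAt (hB.mem_nhds hx.2)
    refine ⟨ofCoordRep p f, fun x hx => smoothAt_ofCoordRep (hVs x hx) (hfs x hx), fun x hx => ?_⟩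
    ext1 v
    refine toCoord_injective (hVs x hx) ?_
    have h1 := toCoord_conn_ofCoordRep D₁ (hVs x hx) (hfs x hx) (toCoord p x v)
    rw [ofCoord_toCoord (hVs x hx)] at h1
    refine h1.trans ((hfα (ψ x) hx.2 _).trans ?_)
    rw [coordDeriv, ψ.left_inv hx.1]
    change toCoord p x (D₂ X x (ofCoord p x (toCoord p x v))) = _
    rw [ofCoord_toCoord (hVs x hx)]
    rfl

end Coordinates

/-! ### Iteration of the recursion -/

section Chain

variable {n : ℕ} {M : Type*} [TopologicalSpace M] [T2Space M]
  [ChartedSpace (EuclideanSpace ℝ (Fin n)) M] [IsManifold (𝓡 n) ∞ M]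
  {c : MulField n M} {e E : VField n M} {D₁ D₂ : AffConn n M}

/-- If the Lenard-Magri relation can be solved on `V`, it can be iterated from any solution. -/
theorem exists_lenardMagri_chain (hF : IsFManifold c e) (hD : HydroEquivalent c D₁ D₂)
    (hflat₂ : IsFlat D₂) {V : Set M} (hV : IsOpen V)
    (hstep : ∀ X : VField n M, IsSolutionOn D₁ D₂ V X →
      ∃ X' : VField n M, SmoothOn X' V ∧ LenardMagriOn D₁ D₂ V X X')
    {X₀ : VField n M} (hX₀ : IsSolutionOn D₁ D₂ V X₀) :
    ∃ X : ℕ → VField n M, X 0 = X₀ ∧ ∀ p, IsSolutionOn D₁ D₂ V (X p) ∧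
      LenardMagriOn D₁ D₂ V (X p) (X (p + 1)) ∧
      (CommutesOn D₁ (mulBy c E) V X₀ → CommutesOn D₁ (mulBy c E) V (X p)) := by
  -- `next` is total but meaningful only on solutions, so `hsol` must be established along the
  -- iteration.
  choose! next hnext using hstep
  let X : ℕ → VField n M := fun p => Nat.rec X₀ (fun _ Y => next Y) p
  have hsol : ∀ p, IsSolutionOn D₁ D₂ V (X p) := fun p => by
    induction p with
    | zero => exact hX₀
    | succ p ih => exact ih.of_lenardMagri hF hD hflat₂ hV (hnext _ ih).1 (hnext _ ih).2
  refine ⟨X, rfl, fun p => ⟨hsol p, (hnext _ (hsol p)).2, fun hc => ?_⟩⟩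
  induction p with
  | zero => exact hc
  | succ p ih => exact CommutesOn.of_lenardMagri hF hD (hsol p).1 (hnext _ (hsol p)).2 ih

end Chain

end FMan

end

theorem theorem27 {n : ℕ} {M : Type*} [TopologicalSpace M] [T2Space M]
    [ChartedSpace (EuclideanSpace ℝ (Fin n)) M] [IsManifold (𝓡 n) ∞ M]
    (c : FMan.MulField n M) (e E : FMan.VField n M) (D₁ D₂ : FMan.AffConn n M)
    (hF : FMan.IsFManifold c e) (hss : FMan.IsSemisimple c)
    (hE : FMan.IsEventualIdentity c e E)
    (hD : FMan.HydroEquivalent c D₁ D₂)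
    (hflat₁ : FMan.IsFlat D₁) (hflat₂ : FMan.IsFlat D₂) :
    -- the next vector field is again a solution
    (∀ (U : Set M) (X X' : FMan.VField n M), IsOpen U →
      FMan.IsSolutionOn D₁ D₂ U X → FMan.SmoothOn X' U → FMan.LenardMagriOn D₁ D₂ U X X' →
      FMan.IsSolutionOn D₁ D₂ U X') ∧
    -- commutation with `L = E ∘` is preserved
    (∀ (U : Set M) (X X' : FMan.VField n M), IsOpen U →
      FMan.IsSolutionOn D₁ D₂ U X → FMan.SmoothOn X' U → FMan.LenardMagriOn D₁ D₂ U X X' →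
      FMan.CommutesOn D₁ (FMan.mulBy c E) U X → FMan.CommutesOn D₁ (FMan.mulBy c E) U X') ∧
    -- the recursion can be carried out locally, for all `p` at once, from any solution
    (∀ (U : Set M) (X₀ : FMan.VField n M), IsOpen U → FMan.IsSolutionOn D₁ D₂ U X₀ →
      ∀ x ∈ U, ∃ V : Set M, IsOpen V ∧ x ∈ V ∧ V ⊆ U ∧
        ∃ X : ℕ → FMan.VField n M, X 0 = X₀ ∧
          ∀ p, FMan.IsSolutionOn D₁ D₂ V (X p) ∧
            FMan.LenardMagriOn D₁ D₂ V (X p) (X (p + 1)) ∧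
            (FMan.CommutesOn D₁ (FMan.mulBy c E) U X₀ →
              FMan.CommutesOn D₁ (FMan.mulBy c E) V (X p))) ∧
    -- the Lenard-Magri chain: flat frames of the first connection exist locally ...
    (∀ x : M, ∃ U : Set M, IsOpen U ∧ x ∈ U ∧
      ∃ X₀ : Fin n → FMan.VField n M, FMan.IsFlatFrameOn D₁ U X₀) ∧
    -- ... and each of them is the starting point of a chain
    (∀ (U : Set M) (X₀ : Fin n → FMan.VField n M), IsOpen U → FMan.IsFlatFrameOn D₁ U X₀ →
      ∀ x ∈ U, ∃ V : Set M, IsOpen V ∧ x ∈ V ∧ V ⊆ U ∧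
        ∃ X : ℕ → Fin n → FMan.VField n M, X 0 = X₀ ∧
          ∀ p α, FMan.IsSolutionOn D₁ D₂ V (X p α) ∧
            FMan.LenardMagriOn D₁ D₂ V (X p α) (X (p + 1) α) ∧
            FMan.CommutesOn D₁ (FMan.mulBy c E) V (X p α)) := by
  have hD₁ := hD.left.smooth
  have hD₂ := hD.right.smooth
  refine ⟨fun U X X' hU hX hX' h => hX.of_lenardMagri hF hD hflat₂ hU hX' h,
    fun U X X' hU hX hX' h hc => FMan.CommutesOn.of_lenardMagri hF hD hX.1 h hc, ?_, ?_, ?_⟩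
  · intro U X₀ hU hX₀ x hx
    obtain ⟨V, hV, hxV, hVU, -, hstep⟩ :=
      FMan.exists_nhds_flatFrame_and_lenardMagri hD₁ hflat₁ hU hx
    obtain ⟨X, hX0, hX⟩ := FMan.exists_lenardMagri_chain (E := E) hF hD hflat₂ hV
      (hstep D₂ hD₂) (hX₀.mono hVU)
    exact ⟨V, hV, hxV, hVU, X, hX0, fun p => ⟨(hX p).1, (hX p).2.1,
      fun hc => (hX p).2.2 fun y hy => hc y (hVU hy)⟩⟩
  · intro x
    obtain ⟨V, hV, hxV, -, hframe, -⟩ :=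
      FMan.exists_nhds_flatFrame_and_lenardMagri hD₁ hflat₁ isOpen_univ (Set.mem_univ x)
    exact ⟨V, hV, hxV, hframe⟩
  · intro U X₀ hU hX₀ x hx
    -- One neighbourhood serves every member of the frame.
    obtain ⟨V, hV, hxV, hVU, -, hstep⟩ :=
      FMan.exists_nhds_flatFrame_and_lenardMagri hD₁ hflat₁ hU hx
    have hflat : ∀ α, ∀ y ∈ V, FMan.dVF D₁ (X₀ α) y = 0 := fun α y hy => hX₀.2.1 α y (hVU hy)
    have hchain := fun α => FMan.exists_lenardMagri_chain (E := E) hF hD hflat₂ hV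
      (hstep D₂ hD₂)
      (FMan.isSolutionOn_of_flat hF hD hflat₂ hV (fun y hy => hX₀.1 α y (hVU hy)) (hflat α))
    choose X hX0 hX using hchain
    exact ⟨V, hV, hxV, hVU, fun p α => X α p, funext hX0, fun p α => ⟨(hX α p).1, (hX α p).2.1,
      (hX α p).2.2 (FMan.commutesOn_of_flat (hflat α) _)⟩⟩
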